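/- Let $0\le\tau\le 1$, $n\ge 1$, and consider the nominal model $x_{t+1}=A_tx_t+B_tv_t$, $y_t=C_tx_t+D_tv_t$ $(t\ge 0)$, $x_t\in\mathbb R^n$, $y_t\in\mathbb R^p$, with $v_t$ white Gaussian noise of covariance $I_m$, and with $\begin{bmatrix}B_t\\D_t\end{bmatrix}\begin{bmatrix}B_t^T&D_t^T\end{bmatrix}$ positive definite for every $t$. Put $z_t=(x_{t+1},y_t)$ and let $\phi_t(z_t|x_t)$ be the density of $\mathcal N\big(\begin{bmatrix}A_t\\C_t\end{bmatrix}x_t,\begin{bmatrix}B_t\\D_t\end{bmatrix}\begin{bmatrix}B_t^T&D_t^T\end{bmatrix}\big)$. Let $\hat x_0\in\mathbb R^n$, let $V_0$ be positive definite and let $c_t>0$ be tolerances. For Gaussian densities $\tilde f=\mathcal N(\tilde m,\tilde K)$, $f=\mathcal N(m,K)$ on $\mathbb R^d$ with positive definite covariances, put $K=LL^T$, $E=L^{-1}\tilde KL^{-T}$, $q=(\tilde m-m)^TK^{-1}(\tilde m-m)$. The $\tau$-divergence is $$\mathcal D_\tau(\tilde f\|f)=\begin{cases}q+\operatorname{tr}\big(-\log(\tilde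 KK^{-1})+\tilde KK^{-1}-I\big),&\tau=0,\\[2pt] \frac{q}{1-\tau}+\operatorname{tr}\big(-\frac{1}{\tau(1-\tau)}E^\tau+\frac1{1-\tau}\tilde KK^{-1}+\frac1\tau I\big),&0<\tau<1,\\[2pt] \delta_\infty(\tilde m-m)+\operatorname{tr}\big(E\log E-\tilde KK^{-1}+I\big),&\tau=1,\end{cases}$$ where $\delta_\infty(0)=0$ and $\delta_\infty(v)=\infty$ for $v\ne0$. For $P=L_PL_P^T$ positive definite ($L_P$ square) put $Q=L_P^TL_P$ and $$\gamma_\tau(P,\theta)=\begin{cases}-\log\det(I-\theta P)^{-1}+\operatorname{tr}\big((I-\theta P)^{-1}-I\big),&\tau=0,\\[2pt] \operatorname{tr}\big(-\frac1{\tau(1-\tau)}(I-\theta(1-\tau)Q)^{\frac{\tau}{\tau-1}}+\frac1{1-\tau}(I-\theta(1-\tau)Q)^{\frac1{\tau-1}}+\frac1\tau I\big),&0<\tau<1,\\[2pt] \operatorname{tr}\big(\exp(\theta Q)(\theta Q-I)+I\big),&\tau=1.\end{cases}$$ Given the a priori density $\tilde f_t=\mathcal N(\hat x_t,V_t)$ of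 $x_t$, let $\mathcal B_{t,\tau}$ be the set of measurable functions $\tilde\phi_t(z|x)\ge0$ for which $\int\tilde\phi_t(z|x)\tilde f_t(x)\,dx$ is a Gaussian density in $z$ whose $\tau$-divergence from $\bar f_t(z)=\int\phi_t(z|x)\tilde f_t(x)\,dx$ is at most $c_t$. Let $\mathcal G_t$ be the set of measurable $g:\mathbb R^p\to\mathbb R^n$ such that $g(y_t)$ has finite second moment under $\tilde\phi_t\tilde f_t$ for every $\tilde\phi_t\in\mathcal B_{t,\tau}$, and put $J_t(\tilde\phi_t,g)=\iint\|x_{t+1}-g(y_t)\|^2\,\tilde\phi_t(z_t|x_t)\tilde f_t(x_t)\,dx_t\,dz_t$. Then the following recursion, started at $V_0$, is well defined for all $t\ge0$, all matrices $V_t$, $P_{t+1}$ and $C_tV_tC_t^T+D_tD_t^T$ being positive definite: $$G_t=(A_tV_tC_t^T+B_tD_t^T)(C_tV_tC_t^T+D_tD_t^T)^{-1},\qquad P_{t+1}=A_tV_tA_t^T-G_t(C_tV_tC_t^T+D_tD_t^T)G_t^T+B_tB_t^T;$$ there is a unique $\theta_t$ with $\theta_t^{-1}>(1-\tau)\|P_{t+1}\|$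 (spectral norm) and $c_t=\gamma_\tau(P_{t+1},\theta_t)$; and, for any square $L$ with $P_{t+1}=LL^T$ (the result, like $\theta_t$, does not depend on $L$), $$V_{t+1}=\begin{cases}L\big(I-\theta_t(1-\tau)L^TL\big)^{\frac1{\tau-1}}L^T,&0\le\tau<1,\\ L\exp(\theta_tL^TL)L^T,&\tau=1.\end{cases}$$ Moreover, for all observations $(y_t)$, with $\hat x_{t+1}=A_t\hat x_t+G_t(y_t-C_t\hat x_t)$, the following holds at each $t$. The density $\bar f_t$ is $\mathcal N\big(\begin{bmatrix}A_t\\C_t\end{bmatrix}\hat x_t,K_t\big)$ with $$K_t=\begin{bmatrix}K_x&K_{xy}\\K_{yx}&K_y\end{bmatrix}=\begin{bmatrix}A_t\\C_t\end{bmatrix}V_t\begin{bmatrix}A_t^T&C_t^T\end{bmatrix}+\begin{bmatrix}B_t\\D_t\end{bmatrix}\begin{bmatrix}B_t^T&D_t^T\end{bmatrix},$$ and $G_t=K_{xy}K_y^{-1}$, $P_{t+1}=K_x-K_{xy}K_y^{-1}K_{yx}$. The estimator $g_t^\circ(\eta)=A_t\hat x_t+G_t(\eta-C_t\hat x_t)$,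 for which $\hat x_{t+1}=g_t^\circ(y_t)$, solves $$\min_{g\in\mathcal G_t}\ \max_{\tilde\phi_t\in\mathcal B_{t,\tau}}J_t(\tilde\phi_t,g)$$ together with some $\tilde\phi_t^\circ\in\mathcal B_{t,\tau}$: $g_t^\circ\in\mathcal G_t$ minimizes the worst-case error over $\mathcal G_t$, $\tilde\phi_t^\circ$ maximizes $J_t(\cdot,g_t^\circ)$ over $\mathcal B_{t,\tau}$, and $g_t^\circ$ also minimizes $J_t(\tilde\phi_t^\circ,\cdot)$ over $\mathcal G_t$. The density $\int\tilde\phi_t^\circ(z|x)\tilde f_t(x)\,dx$ is $\mathcal N\big(\begin{bmatrix}A_t\\C_t\end{bmatrix}\hat x_t,\begin{bmatrix}\tilde K_x&K_{xy}\\K_{yx}&K_y\end{bmatrix}\big)$ with $V_{t+1}=\tilde K_x-K_{xy}K_y^{-1}K_{yx}$. -/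

import Mathlib

open Matrix MeasureTheory
open scoped ENNReal

noncomputable section

namespace RobustKalman

/-- Squared Euclidean norm of a vector. -/
def sqNorm {ι : Type*} [Fintype ι] (v : ι → ℝ) : ℝ := ∑ i, v i ^ 2

/-- Spectral norm: the operator norm induced by the Euclidean norm. -/
def specNorm {ι : Type*} [Fintype ι] [DecidableEq ι] (M : Matrix ι ι ℝ) : ℝ :=
  ‖Matrix.toEuclideanCLM (n := ι) (𝕜 := ℝ) M‖

/-- Real power of a symmetric positive definite matrix. -/
def matPow {ι : Type*} [Fintype ι] [DecidableEq ι] (M : Matrix ι ι ℝ) (r : ℝ) :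
    Matrix ι ι ℝ :=
  cfc (fun x : ℝ => x ^ r) M

/-- Logarithm of a symmetric positive definite matrix. -/
def matLog {ι : Type*} [Fintype ι] [DecidableEq ι] (M : Matrix ι ι ℝ) : Matrix ι ι ℝ :=
  cfc Real.log M

/-- Symmetric positive semidefinite square root of a positive semidefinite matrix. -/
def matSqrt {ι : Type*} [Fintype ι] [DecidableEq ι] (M : Matrix ι ι ℝ) : Matrix ι ι ℝ :=
  cfc Real.sqrt M

/-- The Lebesgue density of the Gaussian distribution with mean `m` and positive definite
covariance matrix `K`. -/
def gaussPdf {ι : Type*} [Fintype ι] [DecidableEq ι] (m : ι → ℝ) (K : Matrix ι ι ℝ)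
    (z : ι → ℝ) : ℝ :=
  (Real.sqrt ((2 * Real.pi) ^ Fintype.card ι * K.det))⁻¹ *
    Real.exp (-(1 / 2) * ((z - m) ⬝ᵥ (K⁻¹ *ᵥ (z - m))))

/-- `f` is (almost everywhere) the density of a nondegenerate Gaussian distribution with mean `m`
and covariance `K`. -/
def IsGaussianDensity {ι : Type*} [Fintype ι] [DecidableEq ι] (f : (ι → ℝ) → ℝ≥0∞)
    (m : ι → ℝ) (K : Matrix ι ι ℝ) : Prop :=
  K.PosDef ∧ f =ᵐ[volume] fun z => ENNReal.ofReal (gaussPdf m K z)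

/-- The `τ`-divergence (`0 ≤ τ ≤ 1`) of the Gaussian distribution with mean `m'` and covariance
`K'` from the one with mean `m` and covariance `K`. It is written with the normalized covariance
`E = L⁻¹ K' L⁻ᵀ`, where `K = L Lᵀ`; the expression does not depend on the factor, and `L` is taken
to be the symmetric square root of `K`. As `E` is similar to `K' K⁻¹`, the trace of
`log (K' K⁻¹)` in the case `τ = 0` is the trace of `log E`. -/
def tauDiv {ι : Type*} [Fintype ι] [DecidableEq ι] (τ : ℝ) (m' : ι → ℝ) (K' : Matrix ι ι ℝ)
    (m : ι → ℝ) (K : Matrix ι ι ℝ) : EReal :=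
  let L := matSqrt K
  let E := L⁻¹ * K' * (L⁻¹)ᵀ
  let q : ℝ := (m' - m) ⬝ᵥ (K⁻¹ *ᵥ (m' - m))
  if τ = 0 then
    ((q + (-matLog E + K' * K⁻¹ - 1).trace : ℝ) : EReal)
  else if τ = 1 then
    (if m' = m then 0 else ⊤) +
      (((E * matLog E - K' * K⁻¹ + 1).trace : ℝ) : EReal)
  else
    (((1 / (1 - τ)) * q +
      (-(1 / (τ * (1 - τ))) • matPow E τ + (1 / (1 - τ)) • (K' * K⁻¹)
        + (1 / τ) • (1 : Matrix ι ι ℝ)).trace : ℝ) : EReal)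

/-- The function `γ_τ(P, θ)`, written with a square factor `L` of `P = L Lᵀ`. -/
def gammaTau {ι : Type*} [Fintype ι] [DecidableEq ι] (τ : ℝ) (L : Matrix ι ι ℝ) (θ : ℝ) : ℝ :=
  if τ = 0 then
    -Real.log ((1 - θ • (L * Lᵀ))⁻¹).det + ((1 - θ • (L * Lᵀ))⁻¹ - 1).trace
  else if τ = 1 then
    (NormedSpace.exp (θ • (Lᵀ * L)) * (θ • (Lᵀ * L) - 1) + 1).trace
  else
    (-(1 / (τ * (1 - τ))) • matPow (1 - (θ * (1 - τ)) • (Lᵀ * L)) (τ / (τ - 1))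
      + (1 / (1 - τ)) • matPow (1 - (θ * (1 - τ)) • (Lᵀ * L)) (1 / (τ - 1))
      + (1 / τ) • (1 : Matrix ι ι ℝ)).trace

/-- The distortion of `P = L Lᵀ` with risk sensitivity parameter `θ`. -/
def distortion {ι : Type*} [Fintype ι] [DecidableEq ι] (τ : ℝ) (L : Matrix ι ι ℝ) (θ : ℝ) :
    Matrix ι ι ℝ :=
  if τ = 1 then L * NormedSpace.exp (θ • (Lᵀ * L)) * Lᵀ
  else L * matPow (1 - (θ * (1 - τ)) • (Lᵀ * L)) (1 / (τ - 1)) * Lᵀ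

/-- The nominal transition density `φ(z | x)` of `z = (x⁺, y)`, where `x⁺ = A x + B v` and
`y = C x + D v` with `v` standard Gaussian. -/
def nominalTransition {n p m : ℕ} (A : Matrix (Fin n) (Fin n) ℝ) (B : Matrix (Fin n) (Fin m) ℝ)
    (C : Matrix (Fin p) (Fin n) ℝ) (D : Matrix (Fin p) (Fin m) ℝ)
    (x : Fin n → ℝ) (z : Fin n ⊕ Fin p → ℝ) : ℝ :=
  gaussPdf (fromRows A C *ᵥ x) (fromRows B D * (fromRows B D)ᵀ) z

/-- The density `z ↦ ∫ φ(z | x) f(x) dx`. -/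
def marginal {n p : ℕ} (φ : (Fin n → ℝ) → (Fin n ⊕ Fin p → ℝ) → ℝ) (f : (Fin n → ℝ) → ℝ)
    (z : Fin n ⊕ Fin p → ℝ) : ℝ≥0∞ :=
  ∫⁻ x, ENNReal.ofReal (φ x z * f x)

/-- The ball of radius `c` about the transition density `φ`, given the a priori density `f`: all
`φ'(z | x) ≥ 0` for which the marginal `∫ φ'(z | x) f(x) dx` is a Gaussian density whose
`τ`-divergence from the Gaussian density `∫ φ(z | x) f(x) dx` is at most `c`. It is not required
that `φ'(· | x)` integrates to one for each `x`. -/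
def ball {n p : ℕ} (τ : ℝ) (φ : (Fin n → ℝ) → (Fin n ⊕ Fin p → ℝ) → ℝ)
    (f : (Fin n → ℝ) → ℝ) (c : ℝ) : Set ((Fin n → ℝ) → (Fin n ⊕ Fin p → ℝ) → ℝ) :=
  {φ' | Measurable (Function.uncurry φ') ∧ (∀ x z, 0 ≤ φ' x z) ∧
    ∃ m' K' m K, IsGaussianDensity (marginal φ' f) m' K' ∧ IsGaussianDensity (marginal φ f) m K ∧
      tauDiv τ m' K' m K ≤ (c : EReal)}

/-- The mean square error of the estimator `g(y)` of `x⁺`, where `z = (x⁺, y)`, under the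
transition density `φ` and the a priori density `f`. -/
def mse {n p : ℕ} (f : (Fin n → ℝ) → ℝ) (φ : (Fin n → ℝ) → (Fin n ⊕ Fin p → ℝ) → ℝ)
    (g : (Fin p → ℝ) → (Fin n → ℝ)) : ℝ≥0∞ :=
  ∫⁻ z, ∫⁻ x, ENNReal.ofReal (sqNorm (z ∘ Sum.inl - g (z ∘ Sum.inr)) * (φ x z * f x))

/-- The measurable estimators with finite second moment under all `φ(z | x) f(x)`, `φ ∈ S`. -/
def estimators {n p : ℕ} (f : (Fin n → ℝ) → ℝ)
    (S : Set ((Fin n → ℝ) → (Fin n ⊕ Fin p → ℝ) → ℝ)) : Set ((Fin p → ℝ) → (Fin n → ℝ)) :=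
  {g | Measurable g ∧ ∀ φ ∈ S,
    ∫⁻ z, ∫⁻ x, ENNReal.ofReal (sqNorm (g (z ∘ Sum.inr)) * (φ x z * f x)) < ∞}

/-- `(g, φ)` solves `min_{g ∈ E} max_{φ ∈ S} J(φ, g)`: `g` minimizes the worst-case cost over `E`,
and `φ` attains the worst case for `g`. -/
def IsMinimaxSolution {α β : Type*} (J : α → β → ℝ≥0∞) (S : Set α) (E : Set β)
    (g : β) (φ : α) : Prop :=
  g ∈ E ∧ φ ∈ S ∧ IsMinOn (fun g' => ⨆ φ' ∈ S, J φ' g') E g ∧ IsMaxOn (fun φ' => J φ' g) S φ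

/-- The covariance matrix of `z = (x⁺, y)` when `x` has covariance `V`. -/
def jointCov {n p m : ℕ} (A : Matrix (Fin n) (Fin n) ℝ) (B : Matrix (Fin n) (Fin m) ℝ)
    (C : Matrix (Fin p) (Fin n) ℝ) (D : Matrix (Fin p) (Fin m) ℝ) (V : Matrix (Fin n) (Fin n) ℝ) :
    Matrix (Fin n ⊕ Fin p) (Fin n ⊕ Fin p) ℝ :=
  fromRows A C * V * (fromRows A C)ᵀ + fromRows B D * (fromRows B D)ᵀ

/-- The Kalman-like filter with gains `G t`, initial value `x₀` and observations `y t`. -/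
def filter {n p : ℕ} (A : ℕ → Matrix (Fin n) (Fin n) ℝ) (C : ℕ → Matrix (Fin p) (Fin n) ℝ)
    (G : ℕ → Matrix (Fin n) (Fin p) ℝ) (x₀ : Fin n → ℝ) (y : ℕ → Fin p → ℝ) : ℕ → Fin n → ℝ
  | 0 => x₀
  | t + 1 => A t *ᵥ filter A C G x₀ y t + G t *ᵥ (y t - C t *ᵥ filter A C G x₀ y t)

end RobustKalman

end

open RobustKalman

/-! The error and the moment conditions depend on a transition density only through its marginal in
`z = (x⁺, y)`, so each time step is a problem about Gaussian laws `N(m', K')` near `N(m, K)`. Factor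
`K = T Tᵀ` with `T = [[S, G R], [0, R]]`, where `P = S Sᵀ`, `Sᵀ S = diag q` and `K_y = R Rᵀ`. The
error of the nominal conditional mean is `[1, -G] (z - m)`, and `[1, -G] T = [S, 0]`. With `K' = T E
Tᵀ` and `w = T⁻¹ (m' - m)` its mean square is therefore `∑ qᵢ (Eᵢᵢ + wᵢ²)` over the first block,
while the divergence is `tr d(E)` plus a penalty on the mean, for a scalar convex function `d =
scalarDiv τ` with `d(1) = d'(1) = 0`.

Let `h = tilt τ` be the inverse of `d'`. Averaging the tangent inequality of `d` over the
eigenvalues of `E` (Klein's inequality, `sum_scalarDiv_tangent`) gives `tr d(E) ≥ ∑ [d(h(θqᵢ)) + θqᵢ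
(Eᵢᵢ - h(θqᵢ))]`. If `θ` is chosen so that `∑ d(h(θqᵢ)) = c`, the ball condition bounds the error by
`∑ qᵢ h(θqᵢ)`. A mean shift does not help: for `τ < 1` it costs `|w|²/(1-τ)`, which is at least `θ ∑
qᵢ wᵢ²` because `(1-τ)θqᵢ < 1`, and for `τ = 1` it is forbidden (`sum_mul_add_le_of_tauDiv_le`).

The bound is attained at `m' = m`, `E = diag(h(θq), 1)`. This law has the same `G` and `K_y`, so the
nominal estimator is also its conditional mean, and the two form a saddle point
(`isMinimaxSolution_of_regressionCov`). Its conditional covariance `S diag(h(θq)) Sᵀ` is the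
distorted covariance.

The parameter `θ` exists and is unique because `θ ↦ ∑ d(h(θqᵢ))` vanishes at `0`, is continuous and
strictly increasing, and reaches every `c` within the admissible range (`exists_unique_parameter`).
Independence of the factor `L` holds since `Lᵀ L` always has the eigenvalues `q`. The distorted
covariance is again positive definite, so the step can be iterated. -/

noncomputable section

namespace RobustKalman

/-! ### The scalar functions behind the `τ`-divergence -/

/-- The convex function `d` with `tauDiv = tr d(E)` for equal means. -/
def scalarDiv (τ x : ℝ) : ℝ :=
  if τ = 0 then -Real.log x + x - 1
  else if τ = 1 then x * Real.log x - x + 1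
  else -(1 / (τ * (1 - τ))) * x ^ τ + 1 / (1 - τ) * x + 1 / τ

/-- The inverse function of the derivative of `scalarDiv τ`. -/
def tilt (τ y : ℝ) : ℝ :=
  if τ = 1 then Real.exp y else (1 - (1 - τ) * y) ^ (1 / (τ - 1))

theorem tilt_zero (τ : ℝ) : tilt τ 0 = 1 := by
  unfold tilt; split_ifs <;> simp

theorem scalarDiv_one {τ : ℝ} : scalarDiv τ 1 = 0 := by
  unfold scalarDiv
  split_ifs with h0 h1
  · simp
  · simp
  · have : 1 - τ ≠ 0 := fun h => h1 (by linarith)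
    rw [Real.one_rpow]
    field_simp
    ring

theorem tilt_pos {τ y : ℝ} (hy : (1 - τ) * y < 1) : 0 < tilt τ y := by
  unfold tilt
  split_ifs
  · exact Real.exp_pos y
  · exact Real.rpow_pos_of_pos (by linarith) _

theorem tilt_strictMono {τ y y' : ℝ} (hτ : τ ≤ 1) (hy : (1 - τ) * y' < 1) (h : y < y') :
    tilt τ y < tilt τ y' := by
  unfold tilt
  split_ifs with h1
  · exact Real.exp_lt_exp.2 h
  · have h2 : τ < 1 := lt_of_le_of_ne hτ h1
    apply Real.rpow_lt_rpow_of_neg (by linarith)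
    · nlinarith
    · exact div_neg_of_pos_of_neg one_pos (by linarith)

/-- The tangent inequality of the convex function `scalarDiv τ` at the point with slope `y`. -/
theorem scalarDiv_tangent {τ a y : ℝ} (hτ0 : 0 ≤ τ) (hτ1 : τ ≤ 1) (ha : 0 < a)
    (hy : (1 - τ) * y < 1) :
    scalarDiv τ (tilt τ y) + y * (a - tilt τ y) ≤ scalarDiv τ a := by
  have hb := tilt_pos hy
  -- In each case `y` is rewritten as the slope `d'(b)` at `b = tilt τ y`. What remains is `log u ≤
  -- u - 1`, with `u = a / b` for `τ = 0` and `u = b / a` for `τ = 1`, or Bernoulli's inequality for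
  -- exponents in `[0, 1]` at `a / b`.
  rcases eq_or_lt_of_le hτ0 with rfl | h0
  · have hb' : y = 1 - (tilt 0 y)⁻¹ := by
      have : tilt 0 y = (1 - y)⁻¹ := by
        simp only [tilt]; norm_num [Real.rpow_neg_one]
      rw [this, inv_inv]; ring
    set b := tilt 0 y
    rw [hb']
    simp only [scalarDiv, if_true]
    have := Real.log_le_sub_one_of_pos (div_pos ha hb)
    rw [Real.log_div ha.ne' hb.ne'] at this
    have e : (1 - b⁻¹) * (a - b) = a - b - a / b + 1 := by field_simp; ring
    rw [e]; linarith
  rcases eq_or_lt_of_le hτ1 with rfl | h1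
  · have hb' : y = Real.log (tilt 1 y) := by simp [tilt]
    set b := tilt 1 y
    rw [hb']
    simp only [scalarDiv, if_true, one_ne_zero, if_false]
    have := Real.log_le_sub_one_of_pos (div_pos hb ha)
    rw [Real.log_div hb.ne' ha.ne'] at this
    have := mul_le_mul_of_nonneg_left this ha.le
    have e : a * (b / a - 1) = b - a := by field_simp
    rw [e] at this
    linarith
  · have hne0 : τ ≠ 0 := h0.ne'
    have hne1 : τ ≠ 1 := h1.ne
    have hs : 0 < 1 - τ := by linarith
    have hb' : (1 - τ) * y = 1 - (tilt τ y) ^ (τ - 1) := by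
      simp only [tilt, hne1, if_false]
      rw [← Real.rpow_mul (by linarith), one_div, inv_mul_cancel₀ (by linarith), Real.rpow_one]
      ring
    set b := tilt τ y
    simp only [scalarDiv, hne0, hne1, if_false]
    have h := _root_.rpow_one_add_le_one_add_mul_self (s := a / b - 1) (p := τ)
      (by have := div_pos ha hb; linarith) hτ0 hτ1
    rw [add_sub_cancel, Real.div_rpow ha.le hb.le, div_le_iff₀ (Real.rpow_pos_of_pos hb _)] at h
    have hbτ : b ^ τ = b ^ (τ - 1) * b := by
      rw [← Real.rpow_add_one hb.ne']; ring_nf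
    have h' : a ^ τ ≤ b ^ τ + τ * b ^ (τ - 1) * (a - b) := by
      refine h.trans (le_of_eq ?_)
      rw [hbτ]; field_simp
    have hyy : y = (1 - b ^ (τ - 1)) / (1 - τ) := by
      rw [← hb']; field_simp
    rw [hyy]
    have e : -(1 / (τ * (1 - τ))) * a ^ τ + 1 / (1 - τ) * a + 1 / τ -
        (-(1 / (τ * (1 - τ))) * b ^ τ + 1 / (1 - τ) * b + 1 / τ +
        (1 - b ^ (τ - 1)) / (1 - τ) * (a - b)) =
        (b ^ τ + τ * b ^ (τ - 1) * (a - b) - a ^ τ) / (τ * (1 - τ)) := by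
      field_simp; ring
    have : 0 ≤ (b ^ τ + τ * b ^ (τ - 1) * (a - b) - a ^ τ) / (τ * (1 - τ)) :=
      div_nonneg (by linarith) (by positivity)
    linarith

theorem scalarDiv_nonneg {τ a : ℝ} (hτ0 : 0 ≤ τ) (hτ1 : τ ≤ 1) (ha : 0 < a) :
    0 ≤ scalarDiv τ a := by
  have := scalarDiv_tangent (y := 0) hτ0 hτ1 ha (by simp)
  simpa [tilt_zero, scalarDiv_one] using this

/-- By the tangent inequality at slope `y`, passing from `tilt τ y` to the larger point `tilt τ y'`
raises the value by at least `y` times the distance. -/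
theorem scalarDiv_tilt_lt {τ y y' : ℝ} (hτ0 : 0 ≤ τ) (hτ1 : τ ≤ 1) (hy0 : 0 < y)
    (hy : (1 - τ) * y' < 1) (h : y < y') :
    scalarDiv τ (tilt τ y) < scalarDiv τ (tilt τ y') := by
  have hy1 : (1 - τ) * y < 1 := by nlinarith
  have h1 := scalarDiv_tangent hτ0 hτ1 (tilt_pos hy) hy1
  have h2 := mul_pos hy0 (sub_pos.2 (tilt_strictMono hτ1 hy h))
  linarith

theorem exists_tilt_eq {τ a : ℝ} (hτ1 : τ ≤ 1) (ha : 1 < a) :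
    ∃ y, 0 < y ∧ (1 - τ) * y < 1 ∧ tilt τ y = a := by
  rcases eq_or_lt_of_le hτ1 with rfl | h1
  · exact ⟨Real.log a, Real.log_pos ha, by simp, by simp [tilt, Real.exp_log (zero_lt_one.trans ha)]⟩
  · have hs : 0 < 1 - τ := by linarith
    have hp : 0 < a ^ (τ - 1) := Real.rpow_pos_of_pos (by linarith) _
    have hl : a ^ (τ - 1) < 1 := Real.rpow_lt_one_of_one_lt_of_neg ha (by linarith)
    have e : (1 - τ) * ((1 - a ^ (τ - 1)) / (1 - τ)) = 1 - a ^ (τ - 1) := by field_simp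
    refine ⟨(1 - a ^ (τ - 1)) / (1 - τ), div_pos (by linarith) hs, by rw [e]; linarith, ?_⟩
    rw [tilt, if_neg h1.ne, e, sub_sub_cancel, ← Real.rpow_mul (by linarith), one_div,
      mul_inv_cancel₀ (by linarith), Real.rpow_one]

/-- A convex function lies above a supporting line of positive slope, hence is unbounded; this lets
the parameter reach every tolerance. -/
theorem exists_le_scalarDiv_tilt {τ : ℝ} (hτ0 : 0 ≤ τ) (hτ1 : τ ≤ 1) (c : ℝ) :
    ∃ y, 0 < y ∧ (1 - τ) * y < 1 ∧ c ≤ scalarDiv τ (tilt τ y) := by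
  obtain ⟨y, hy0, hy1, -⟩ := exists_tilt_eq hτ1 one_lt_two
  set b := tilt τ y
  have hb : 0 < b := tilt_pos hy1
  -- At this point the line of slope `y` through `(b, d(b))` has height `d(b) + y + |c|`, which
  -- exceeds `c`.
  obtain ⟨y', h0, h1, h2⟩ := exists_tilt_eq (a := 1 + b + |c| / y) hτ1
    (by have : 0 ≤ |c| / y := by positivity
        linarith)
  refine ⟨y', h0, h1, ?_⟩
  have h3 := scalarDiv_tangent hτ0 hτ1 (tilt_pos h1) hy1
  have h4 := scalarDiv_nonneg hτ0 hτ1 hb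
  rw [h2] at h3 ⊢
  have e : y * (1 + b + |c| / y - b) = y + |c| := by field_simp; ring
  change scalarDiv τ b + y * (1 + b + |c| / y - b) ≤ _ at h3
  rw [e] at h3
  linarith [le_abs_self c]

theorem continuousOn_scalarDiv {τ : ℝ} : ContinuousOn (scalarDiv τ) (Set.Ioi 0) := by
  unfold scalarDiv
  have hl : ContinuousOn Real.log (Set.Ioi 0) :=
    Real.continuousOn_log.mono fun x hx => (ne_of_gt hx : x ≠ 0)
  have hr : ContinuousOn (fun x : ℝ => x ^ τ) (Set.Ioi 0) :=
    continuousOn_id.rpow_const fun x hx => Or.inl (ne_of_gt hx)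
  split_ifs <;> fun_prop

theorem continuousOn_tilt {τ : ℝ} : ContinuousOn (tilt τ) {y | (1 - τ) * y < 1} := by
  unfold tilt
  split_ifs
  · fun_prop
  · apply ContinuousOn.rpow_const (by fun_prop)
    intro x hx
    left
    have : (1 - τ) * x < 1 := hx
    linarith

/-- The equation `∑ d(h(s qᵢ)) = c` has exactly one admissible solution. -/
theorem exists_unique_parameter {ι : Type*} [Fintype ι] [Nonempty ι] {τ c : ℝ} (hτ0 : 0 ≤ τ)
    (hτ1 : τ ≤ 1) (hc : 0 < c) {q : ι → ℝ} (hq : ∀ i, 0 < q i) :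
    ∃ θ, 0 < θ ∧ (∀ i, (1 - τ) * (θ * q i) < 1) ∧ ∑ i, scalarDiv τ (tilt τ (θ * q i)) = c ∧
      ∀ s, 0 < s → (∀ i, (1 - τ) * (s * q i) < 1) →
        ∑ i, scalarDiv τ (tilt τ (s * q i)) = c → s = θ := by
  obtain ⟨j, hj⟩ := Finite.exists_max q
  obtain ⟨y, hy0, hy1, hyc⟩ := exists_le_scalarDiv_tilt hτ0 hτ1 c
  have hs : 0 ≤ 1 - τ := by linarith
  -- Dividing by the largest `q j` makes every `s₁ * q i` at most `y`, hence admissible, while the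
  -- `j`-th summand alone already reaches `c`.
  set s₁ := y / q j
  have hs₁ : 0 < s₁ := div_pos hy0 (hq j)
  have hadm : ∀ s ∈ Set.Icc 0 s₁, ∀ i, (1 - τ) * (s * q i) < 1 := by
    intro s hs' i
    refine lt_of_le_of_lt (mul_le_mul_of_nonneg_left ?_ hs) hy1
    calc s * q i ≤ s₁ * q j := mul_le_mul hs'.2 (hj i) (hq i).le hs₁.le
      _ = y := div_mul_cancel₀ _ (hq j).ne'
  have hcont : ContinuousOn (fun s => ∑ i, scalarDiv τ (tilt τ (s * q i))) (Set.Icc 0 s₁) := by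
    refine continuousOn_finsetSum _ fun i _ => ?_
    refine continuousOn_scalarDiv.comp (continuousOn_tilt.comp (by fun_prop) ?_) ?_
    · exact fun s hs' => hadm s hs' i
    · exact fun s hs' => tilt_pos (hadm s hs' i)
  have hmem : c ∈ Set.Icc (∑ i, scalarDiv τ (tilt τ (0 * q i)))
      (∑ i, scalarDiv τ (tilt τ (s₁ * q i))) := by
    constructor
    · simp [tilt_zero, scalarDiv_one, hc.le]
    · refine le_trans ?_ (Finset.single_le_sum (f := fun i => scalarDiv τ (tilt τ (s₁ * q i)))
        (fun i _ => scalarDiv_nonneg hτ0 hτ1 (tilt_pos (hadm s₁ ⟨hs₁.le, le_rfl⟩ i)))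
        (Finset.mem_univ j))
      rwa [div_mul_cancel₀ _ (hq j).ne']
  have hmono : ∀ s s', 0 < s → s < s' → (∀ i, (1 - τ) * (s' * q i) < 1) →
      ∑ i, scalarDiv τ (tilt τ (s * q i)) < ∑ i, scalarDiv τ (tilt τ (s' * q i)) :=
    fun s s' h0 h h' => Finset.sum_lt_sum_of_nonempty Finset.univ_nonempty fun i _ =>
      scalarDiv_tilt_lt hτ0 hτ1 (mul_pos h0 (hq i)) (h' i) (mul_lt_mul_of_pos_right h (hq i))
  obtain ⟨θ, hθ, hθc⟩ := intermediate_value_Icc hs₁.le hcont hmem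
  have hθ0 : 0 < θ := by
    refine lt_of_le_of_ne hθ.1 fun h => hc.ne ?_
    rw [← hθc, ← h]
    simp [tilt_zero, scalarDiv_one]
  refine ⟨θ, hθ0, hadm θ hθ, hθc, fun s h0 h1 h2 => ?_⟩
  rcases lt_trichotomy s θ with h | h | h
  · exact absurd (h2.trans hθc.symm) (hmono s θ h0 h (hadm θ hθ)).ne
  · exact h
  · exact absurd (hθc.trans h2.symm) (hmono θ s hθ0 h h1).ne

/-! ### Orthogonal diagonalization -/

section Diagonalization

theorem mul_diagonal_mul_transpose {ι κ : Type*} [Fintype κ] [DecidableEq κ] (T : Matrix ι κ ℝ)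
    (a : κ → ℝ) :
    (T * diagonal a) * (T * diagonal a)ᵀ = T * diagonal (fun i => a i * a i) * Tᵀ := by
  rw [← diagonal_mul_diagonal, transpose_mul, diagonal_transpose]
  simp only [Matrix.mul_assoc]

variable {ι : Type*} [Fintype ι] [DecidableEq ι]

theorem transpose_mul_self_of_orthogonal {U : Matrix ι ι ℝ} (hU : U * Uᵀ = 1) : Uᵀ * U = 1 :=
  mul_eq_one_comm.1 hU

/-- On the finite spectrum `f` agrees with a Lagrange interpolating polynomial, and polynomials
commute with orthogonal conjugation. -/
theorem cfc_orthogonal_diagonal (f : ℝ → ℝ) {U : Matrix ι ι ℝ} (hU : U * Uᵀ = 1) (d : ι → ℝ) :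
    cfc f (U * diagonal d * Uᵀ) = U * diagonal (fun i => f (d i)) * Uᵀ := by
  have hU' := transpose_mul_self_of_orthogonal hU
  let u : unitary (Matrix ι ι ℝ) := ⟨U, by
    rw [Unitary.mem_iff, star_eq_conjTranspose, conjTranspose_eq_transpose_of_trivial]
    exact ⟨hU', hU⟩⟩
  have hstar : star U = Uᵀ := by
    rw [star_eq_conjTranspose, conjTranspose_eq_transpose_of_trivial]
  have hA : IsSelfAdjoint (U * diagonal d * Uᵀ) := by
    rw [isSelfAdjoint_iff, star_eq_conjTranspose, conjTranspose_eq_transpose_of_trivial]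
    simp [Matrix.mul_assoc]
  have hspec : spectrum ℝ (U * diagonal d * Uᵀ) = Set.range d := by
    have := Unitary.spectrum_star_right_conjugate (R := ℝ) (a := diagonal d) (U := u)
    rw [← spectrum_diagonal d, ← this]
    simp [u, hstar]
  set p : Polynomial ℝ := Lagrange.interpolate (Finset.univ.image d) id f
  have hp : ∀ i, p.eval (d i) = f (d i) := fun i =>
    Lagrange.eval_interpolate_at_node f (v := id) (Function.injective_id.injOn)
      (Finset.mem_image_of_mem d (Finset.mem_univ i))
  have hconj : ∀ r : Polynomial ℝ, Polynomial.aeval (U * diagonal d * Uᵀ) r =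
      U * diagonal (fun i => r.eval (d i)) * Uᵀ := by
    intro r
    induction r using Polynomial.induction_on' with
    | add r s hr hs =>
      rw [map_add, hr, hs, ← Matrix.add_mul, ← Matrix.mul_add, diagonal_add]
      simp
    | monomial k a =>
      have hpow : (U * diagonal d * Uᵀ) ^ k = U * diagonal (fun i => d i ^ k) * Uᵀ := by
        induction k with
        | zero => simp [hU]
        | succ k ih =>
          rw [pow_succ, ih]
          calc U * diagonal (fun i => d i ^ k) * Uᵀ * (U * diagonal d * Uᵀ)
              = U * diagonal (fun i => d i ^ k) * (Uᵀ * U) * diagonal d * Uᵀ := by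
                simp only [Matrix.mul_assoc]
            _ = _ := by
                rw [hU', Matrix.mul_one, Matrix.mul_assoc U, diagonal_mul_diagonal]
                simp only [pow_succ]
      rw [Polynomial.aeval_monomial, hpow, ← Algebra.smul_def]
      have : (fun i => (Polynomial.monomial k a).eval (d i)) = a • fun i => d i ^ k := by
        ext i; simp
      rw [this, diagonal_smul, Matrix.mul_smul, Matrix.smul_mul]
  have h1 : cfc f (U * diagonal d * Uᵀ) = cfc p.eval (U * diagonal d * Uᵀ) := by
    apply cfc_congr
    rw [hspec]
    rintro _ ⟨i, rfl⟩
    exact (hp i).symm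
  rw [h1, cfc_polynomial p _ hA, hconj]
  simp only [hp]

theorem exp_orthogonal_diagonal {U : Matrix ι ι ℝ} (hU : U * Uᵀ = 1) (d : ι → ℝ) :
    NormedSpace.exp (U * diagonal d * Uᵀ) = U * diagonal (fun i => Real.exp (d i)) * Uᵀ := by
  have hinv : U⁻¹ = Uᵀ := inv_eq_right_inv hU
  have hunit : IsUnit U := IsUnit.of_mul_eq_one _ hU
  rw [← hinv, Matrix.exp_conj U _ hunit, Matrix.exp_diagonal]
  congr 3
  ext i
  rw [Pi.coe_exp, Real.exp_eq_exp_ℝ]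

theorem exists_orthogonal_diagonal_of_posDef {M : Matrix ι ι ℝ} (hM : M.PosDef) :
    ∃ (U : Matrix ι ι ℝ) (d : ι → ℝ), U * Uᵀ = 1 ∧ (∀ i, 0 < d i) ∧ M = U * diagonal d * Uᵀ := by
  refine ⟨hM.1.eigenvectorUnitary, hM.1.eigenvalues, ?_, hM.eigenvalues_pos, ?_⟩
  · have := (Unitary.mem_iff.1 hM.1.eigenvectorUnitary.2).2
    rwa [star_eq_conjTranspose, conjTranspose_eq_transpose_of_trivial] at this
  · have := hM.1.spectral_theorem
    rw [Unitary.conjStarAlgAut_apply, star_eq_conjTranspose,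
      conjTranspose_eq_transpose_of_trivial] at this
    exact this

theorem posDef_mul_diagonal_mul_transpose {T : Matrix ι ι ℝ} (hT : IsUnit T) {d : ι → ℝ}
    (hd : ∀ i, 0 < d i) : (T * diagonal d * Tᵀ).PosDef := by
  have := (PosDef.diagonal hd).mul_mul_conjTranspose_same (B := T)
    (vecMul_injective_of_isUnit hT)
  rwa [conjTranspose_eq_transpose_of_trivial] at this

/-- The norm on the right is the sup norm of `d`; the C*-norm is invariant under multiplication by
unitaries. -/
theorem specNorm_orthogonal_diagonal {U : Matrix ι ι ℝ} (hU : U * Uᵀ = 1) (d : ι → ℝ) :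
    specNorm (U * diagonal d * Uᵀ) = ‖d‖ := by
  have hstar : star U = Uᵀ := by
    rw [star_eq_conjTranspose, conjTranspose_eq_transpose_of_trivial]
  let u : unitary (Matrix ι ι ℝ) := ⟨U, by
    rw [Unitary.mem_iff, hstar]
    exact ⟨transpose_mul_self_of_orthogonal hU, hU⟩⟩
  open scoped Matrix.Norms.L2Operator in
  have h : ‖(u : Matrix ι ι ℝ) * diagonal d * star (u : Matrix ι ι ℝ)‖ = ‖d‖ := by
    rw [← Unitary.coe_star, CStarRing.norm_mul_coe_unitary, CStarRing.norm_coe_unitary_mul, l2_opNorm_diagonal]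
  rw [← h, hstar]
  rfl

theorem trace_orthogonal_diagonal {U : Matrix ι ι ℝ} (hU : U * Uᵀ = 1) (d : ι → ℝ) :
    (U * diagonal d * Uᵀ).trace = ∑ i, d i := by
  rw [trace_mul_comm, ← Matrix.mul_assoc, transpose_mul_self_of_orthogonal hU, Matrix.one_mul,
    trace_diagonal]

theorem exists_isUnit_mul_transpose {K : Matrix ι ι ℝ} (hK : K.PosDef) :
    ∃ S : Matrix ι ι ℝ, IsUnit S ∧ K = S * Sᵀ := by
  obtain ⟨U, d, hU, hd, rfl⟩ := exists_orthogonal_diagonal_of_posDef hK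
  refine ⟨U * diagonal fun i => Real.sqrt (d i), ?_, ?_⟩
  · refine (IsUnit.of_mul_eq_one _ hU).mul ((isUnit_iff_isUnit_det _).2 ?_)
    rw [det_diagonal]
    exact (Finset.prod_pos fun i _ => Real.sqrt_pos.2 (hd i)).ne'.isUnit
  · rw [mul_diagonal_mul_transpose]
    simp only [fun i => Real.mul_self_sqrt (hd i).le]

end Diagonalization

/-! ### Gaussian densities: change of variables, second moments, uniqueness of parameters -/

section Gaussian

open ProbabilityTheory

variable {ι κ : Type*} [Fintype ι] [Fintype κ]

/-- The standard Gaussian measure on `ι → ℝ`. -/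
def stdGauss (ι : Type*) [Fintype ι] : Measure (ι → ℝ) :=
  Measure.pi fun _ => gaussianReal 0 1

instance : IsProbabilityMeasure (stdGauss ι) := by
  unfold stdGauss; infer_instance

theorem memLp_stdGauss_eval (i : ι) : MemLp (fun w : ι → ℝ => w i) 2 (stdGauss ι) :=
  (memLp_id_gaussianReal 2).comp_measurePreserving (measurePreserving_eval _ i)

theorem integral_stdGauss_eval (i : ι) : ∫ w : ι → ℝ, w i ∂stdGauss ι = 0 := by
  rw [stdGauss, integral_eval, integral_id_gaussianReal]

theorem integrable_stdGauss_eval_mul (i j : ι) :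
    Integrable (fun w : ι → ℝ => w i * w j) (stdGauss ι) :=
  (memLp_stdGauss_eval i).integrable_mul (memLp_stdGauss_eval j)

theorem sqNorm_nonneg (v : κ → ℝ) : 0 ≤ sqNorm v := Finset.sum_nonneg fun _ _ => sq_nonneg _

theorem continuous_sqNorm : Continuous (sqNorm : (κ → ℝ) → ℝ) := by
  unfold sqNorm; fun_prop

theorem integrable_stdGauss_affine_sq (a : ι → ℝ) (b : ℝ) :
    Integrable (fun w : ι → ℝ => (a ⬝ᵥ w + b) ^ 2) (stdGauss ι) := by
  have h : MemLp (fun w : ι → ℝ => a ⬝ᵥ w + b) 2 (stdGauss ι) :=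
    (memLp_finsetSum _ fun i _ => (memLp_stdGauss_eval i).const_mul (a i)).add (memLp_const b)
  exact h.integrable_sq

variable [DecidableEq ι]

theorem continuous_gaussPdf (m : ι → ℝ) (K : Matrix ι ι ℝ) : Continuous (gaussPdf m K) := by
  unfold gaussPdf
  fun_prop

theorem gaussPdf_nonneg (m : ι → ℝ) (K : Matrix ι ι ℝ) (z : ι → ℝ) : 0 ≤ gaussPdf m K z := by
  unfold gaussPdf
  positivity

theorem gaussPdf_zero_one (w : ι → ℝ) :
    gaussPdf 0 1 w = ∏ i, gaussianPDFReal 0 1 (w i) := by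
  simp only [gaussPdf, gaussianPDFReal, Finset.prod_mul_distrib, Finset.prod_const,
    Finset.card_univ, ← Real.exp_sum]
  congr 1
  · rw [det_one, mul_one, inv_pow]
    congr 1
    rw [NNReal.coe_one, mul_one, Real.sqrt_eq_iff_mul_self_eq (by positivity) (by positivity),
      ← mul_pow, Real.mul_self_sqrt (by positivity)]
  · congr 1
    rw [sub_zero, inv_one, one_mulVec, dotProduct, Finset.mul_sum]
    refine Finset.sum_congr rfl fun i _ => ?_
    simp only [sub_zero, NNReal.coe_one]
    ring

theorem withDensity_gaussPdf_zero_one :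
    (volume : Measure (ι → ℝ)).withDensity (fun w => ENNReal.ofReal (gaussPdf 0 1 w)) =
      stdGauss ι := by
  refine (Measure.pi_eq fun s hs => ?_).symm
  rw [withDensity_apply _ (MeasurableSet.univ_pi hs)]
  simp only [gaussPdf_zero_one]
  rw [← ofReal_integral_eq_lintegral_ofReal]
  · rw [← integral_indicator (MeasurableSet.univ_pi hs)]
    have : (Set.univ.pi s).indicator (fun w : ι → ℝ => ∏ i, gaussianPDFReal 0 1 (w i)) =
        fun w => ∏ i, (s i).indicator (gaussianPDFReal 0 1) (w i) := by
      ext w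
      by_cases hw : w ∈ Set.univ.pi s
      · rw [Set.indicator_of_mem hw]
        exact Finset.prod_congr rfl fun i _ => (Set.indicator_of_mem (hw i trivial) _).symm
      · rw [Set.indicator_of_notMem hw]
        simp only [Set.mem_pi, not_forall] at hw
        obtain ⟨i, -, hi⟩ := hw
        exact (Finset.prod_eq_zero (Finset.mem_univ i) (Set.indicator_of_notMem hi _)).symm
    rw [this, integral_fintype_prod_volume_eq_prod, ENNReal.ofReal_prod_of_nonneg]
    · refine Finset.prod_congr rfl fun i _ => ?_
      rw [integral_indicator (hs i), gaussianReal_apply_eq_integral _ one_ne_zero]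
    · exact fun i _ => integral_nonneg fun x => Set.indicator_nonneg
        (fun x _ => gaussianPDFReal_nonneg _ _ _) _
  · exact (Integrable.fintype_prod fun i => integrable_gaussianPDFReal 0 1).integrableOn
  · exact ae_of_all _ fun w => Finset.prod_nonneg fun i _ => gaussianPDFReal_nonneg _ _ _

theorem gaussPdf_affine {S : Matrix ι ι ℝ} (hS : IsUnit S) (m b : ι → ℝ) (K : Matrix ι ι ℝ)
    (w : ι → ℝ) :
    gaussPdf (b + S *ᵥ m) (S * K * Sᵀ) (b + S *ᵥ w) = |S.det|⁻¹ * gaussPdf m K w := by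
  have hd := (isUnit_iff_isUnit_det S).1 hS
  unfold gaussPdf
  rw [← mul_assoc]
  congr 1
  · rw [det_mul, det_mul, det_transpose, ← mul_inv]
    congr 1
    rw [← Real.sqrt_mul_self_eq_abs, ← Real.sqrt_mul (mul_self_nonneg _)]
    congr 1; ring
  · congr 2
    have e : b + S *ᵥ w - (b + S *ᵥ m) = S *ᵥ (w - m) := by
      rw [mulVec_sub]; abel
    rw [e, Matrix.mul_inv_rev, Matrix.mul_inv_rev, mulVec_mulVec, Matrix.mul_assoc, Matrix.mul_assoc,
     
      nonsing_inv_mul _ hd, Matrix.mul_one, dotProduct_comm, dotProduct_mulVec, ← mulVec_transpose,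
      mulVec_mulVec, ← Matrix.mul_assoc, mul_nonsing_inv _ (by rwa [det_transpose]),
      Matrix.one_mul, dotProduct_comm]

/-- Change of variables to the standard Gaussian measure. -/
theorem lintegral_mul_gaussPdf {S : Matrix ι ι ℝ} (hS : IsUnit S) (m : ι → ℝ)
    {F : (ι → ℝ) → ℝ≥0∞} (hF : Measurable F) :
    ∫⁻ z, F z * ENNReal.ofReal (gaussPdf m (S * Sᵀ) z) =
      ∫⁻ w, F (m + S *ᵥ w) ∂stdGauss ι := by
  have hd : S.det ≠ 0 := ((isUnit_iff_isUnit_det S).1 hS).ne_zero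
  have hmap := Real.map_matrix_volume_pi_eq_smul_volume_pi hd
  have hm : Measurable fun w : ι → ℝ => m + S *ᵥ w := by
    have : Continuous fun w : ι → ℝ => m + S *ᵥ w := by fun_prop
    exact this.measurable
  -- Lebesgue measure as a multiple of its own image under the affine map, so that the integral can
  -- be pulled back.
  have hvol : (volume : Measure (ι → ℝ)) =
      ENNReal.ofReal |S.det| • (volume.map fun w : ι → ℝ => m + S *ᵥ w) := by
    have h1 : (volume.map fun w : ι → ℝ => m + S *ᵥ w) =
        ENNReal.ofReal |S.det⁻¹| • (volume : Measure (ι → ℝ)) := by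
      have : (fun w : ι → ℝ => m + S *ᵥ w) = (fun v => m + v) ∘ (toLin' S) := rfl
      rw [this, ← Measure.map_map (measurable_const_add m)
        (LinearMap.continuous_of_finiteDimensional (toLin' S)).measurable, hmap,
        Measure.map_smul, map_add_left_eq_self]
    rw [h1, smul_smul, ← ENNReal.ofReal_mul (abs_nonneg _), ← abs_mul, mul_inv_cancel₀ hd]
    simp
  have hG : Measurable fun z => F z * ENNReal.ofReal (gaussPdf m (S * Sᵀ) z) :=
    hF.mul (continuous_gaussPdf _ _).measurable.ennreal_ofReal
  conv_lhs => rw [hvol]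
  rw [lintegral_smul_measure, lintegral_map hG hm, ← withDensity_gaussPdf_zero_one,
    lintegral_withDensity_eq_lintegral_mul _
      (continuous_gaussPdf _ _).measurable.ennreal_ofReal
      (show Measurable fun w => F (m + S *ᵥ w) from hF.comp hm), smul_eq_mul,
    ← lintegral_const_mul _ (show Measurable fun w =>
      F (m + S *ᵥ w) * ENNReal.ofReal (gaussPdf m (S * Sᵀ) (m + S *ᵥ w)) from hG.comp hm)]
  refine lintegral_congr fun w => ?_
  have h := gaussPdf_affine hS 0 m 1 w
  rw [mulVec_zero, add_zero, Matrix.mul_one] at h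
  simp only [Pi.mul_apply, h]
  rw [mul_left_comm, ← ENNReal.ofReal_mul (abs_nonneg _), ← mul_assoc,
    mul_inv_cancel₀ (abs_ne_zero.2 hd), one_mul, mul_comm]


theorem integral_stdGauss_eval_mul (i j : ι) :
    ∫ w : ι → ℝ, w i * w j ∂stdGauss ι = if i = j then 1 else 0 := by
  split_ifs with h
  · subst h
    have h1 := integral_comp_eval (μ := fun _ : ι => gaussianReal 0 1) (i := i)
      (f := fun x : ℝ => x * x) (by fun_prop)
    have h2 := variance_fun_id_gaussianReal (μ := 0) (v := 1)
    rw [variance_of_integral_eq_zero (by fun_prop) integral_id_gaussianReal] at h2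
    rw [stdGauss, h1]
    simpa [sq] using h2
  · have hind : iIndepFun (fun (i : ι) (w : ι → ℝ) => w i) (stdGauss ι) :=
      iIndepFun_pi (X := fun _ x => x) fun _ => by fun_prop
    rw [(hind.indepFun h).integral_fun_mul_eq_mul_integral 
        (memLp_stdGauss_eval i).1 (memLp_stdGauss_eval j).1,
      integral_stdGauss_eval, zero_mul]

theorem integral_stdGauss_affine_sq (a : ι → ℝ) (b : ℝ) :
    ∫ w : ι → ℝ, (a ⬝ᵥ w + b) ^ 2 ∂stdGauss ι = a ⬝ᵥ a + b ^ 2 := by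
  have e : ∀ w : ι → ℝ, (a ⬝ᵥ w + b) ^ 2 =
      ∑ i, ∑ j, a i * a j * (w i * w j) + (∑ i, 2 * b * a i * w i + b ^ 2) := by
    intro w
    have : a ⬝ᵥ w * a ⬝ᵥ w = ∑ i, ∑ j, a i * a j * (w i * w j) := by
      rw [dotProduct, Finset.sum_mul_sum]
      exact Finset.sum_congr rfl fun i _ => Finset.sum_congr rfl fun j _ => by ring
    rw [← this, add_sq, dotProduct]
    have : 2 * (∑ i, a i * w i) * b = ∑ i, 2 * b * a i * w i := by
      rw [Finset.mul_sum, Finset.sum_mul]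
      exact Finset.sum_congr rfl fun j _ => by ring
    rw [this]; ring
  have h1 : ∀ i j : ι, Integrable (fun w : ι → ℝ => a i * a j * (w i * w j)) (stdGauss ι) :=
    fun i j => (integrable_stdGauss_eval_mul i j).const_mul _
  have h2 : ∀ i : ι, Integrable (fun w : ι → ℝ => 2 * b * a i * w i) (stdGauss ι) :=
    fun i => ((memLp_stdGauss_eval i).integrable (by norm_num)).const_mul _
  simp only [e]
  have h3 : Integrable (fun w : ι → ℝ => ∑ i, 2 * b * a i * w i) (stdGauss ι) :=
    integrable_finsetSum _ fun i _ => h2 i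
  have h4 : Integrable (fun w : ι → ℝ => ∑ i, 2 * b * a i * w i + b ^ 2) (stdGauss ι) :=
    h3.add (integrable_const _)
  rw [integral_add (integrable_finsetSum _ fun i _ => integrable_finsetSum _ fun j _ => h1 i j) h4,
    integral_add h3 (integrable_const _),
    integral_finsetSum _ fun i _ => integrable_finsetSum _ fun j _ => h1 i j,
    integral_finsetSum _ fun i _ => h2 i]
  simp only [integral_finsetSum _ fun j _ => h1 _ j, integral_const_mul,
    integral_stdGauss_eval_mul, integral_stdGauss_eval]
  simp [dotProduct]

theorem lintegral_stdGauss_sqNorm (M : Matrix κ ι ℝ) (b : κ → ℝ) :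
    ∫⁻ w, ENNReal.ofReal (sqNorm (M *ᵥ w + b)) ∂stdGauss ι =
      ENNReal.ofReal ((M * Mᵀ).trace + sqNorm b) := by
  have hint : Integrable (fun w => sqNorm (M *ᵥ w + b)) (stdGauss ι) :=
    integrable_finsetSum _ fun i _ => integrable_stdGauss_affine_sq (M i) (b i)
  rw [← ofReal_integral_eq_lintegral_ofReal hint
    (ae_of_all _ fun w => Finset.sum_nonneg fun i _ => sq_nonneg _), trace, sqNorm,
    ← Finset.sum_add_distrib]
  congr 1
  refine (integral_finsetSum _ fun i _ => integrable_stdGauss_affine_sq (M i) (b i)).trans ?_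
  exact Finset.sum_congr rfl fun i _ => integral_stdGauss_affine_sq (M i) (b i)

/-- Second moments of a Gaussian density. -/
theorem lintegral_sqNorm_gaussPdf {K : Matrix ι ι ℝ} (hK : K.PosDef) (m : ι → ℝ)
    (M : Matrix κ ι ℝ) (b : κ → ℝ) :
    ∫⁻ z, ENNReal.ofReal (sqNorm (M *ᵥ z + b)) * ENNReal.ofReal (gaussPdf m K z) =
      ENNReal.ofReal ((M * K * Mᵀ).trace + sqNorm (M *ᵥ m + b)) := by
  obtain ⟨S, hS, rfl⟩ := exists_isUnit_mul_transpose hK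
  have hc : Continuous fun z => sqNorm (M *ᵥ z + b) := continuous_sqNorm.comp (by fun_prop)
  rw [lintegral_mul_gaussPdf hS m hc.measurable.ennreal_ofReal]
  have e : ∀ w, M *ᵥ (m + S *ᵥ w) + b = (M * S) *ᵥ w + (M *ᵥ m + b) := by
    intro w
    rw [mulVec_add, mulVec_mulVec]; abel
  simp only [e, lintegral_stdGauss_sqNorm, transpose_mul, Matrix.mul_assoc]

theorem lintegral_gaussPdf {K : Matrix ι ι ℝ} (hK : K.PosDef) (m : ι → ℝ) :
    ∫⁻ z, ENNReal.ofReal (gaussPdf m K z) = 1 := by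
  obtain ⟨S, hS, rfl⟩ := exists_isUnit_mul_transpose hK
  have := lintegral_mul_gaussPdf hS m (F := fun _ => 1) measurable_const
  simpa using this

/-- A Gaussian density determines its mean and covariance. -/
theorem IsGaussianDensity.unique {f : (ι → ℝ) → ℝ≥0∞} {m m' : ι → ℝ} {K K' : Matrix ι ι ℝ}
    (h : IsGaussianDensity f m K) (h' : IsGaussianDensity f m' K') : m = m' ∧ K = K' := by
  -- Second moments of all affine functionals `a ⬝ᵥ z + b` are compared. Subtracting the cases `b =
  -- 1` and `b = -1` isolates the mean, `b = 0` then gives the quadratic form of the covariance, and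
  -- polarization on basis vectors gives its entries.
  have key : ∀ (a : ι → ℝ) (b : ℝ),
      a ⬝ᵥ K *ᵥ a + (a ⬝ᵥ m + b) ^ 2 = a ⬝ᵥ K' *ᵥ a + (a ⬝ᵥ m' + b) ^ 2 := by
    intro a b
    have e : ∀ {m : ι → ℝ} {K : Matrix ι ι ℝ}, IsGaussianDensity f m K →
        ∫⁻ z, ENNReal.ofReal (sqNorm (replicateRow Unit a *ᵥ z + fun _ => b)) * f z =
        ENNReal.ofReal (a ⬝ᵥ K *ᵥ a + (a ⬝ᵥ m + b) ^ 2) := by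
      intro m K h
      have h1 := lintegral_sqNorm_gaussPdf h.1 m (replicateRow Unit a) fun _ => b
      have h2 : ∀ v, sqNorm (replicateRow Unit a *ᵥ v + fun _ => b) = (a ⬝ᵥ v + b) ^ 2 := by
        intro v
        simp [sqNorm, mulVec, replicateRow_apply, dotProduct]
      have h3 : (replicateRow Unit a * K * (replicateRow Unit a)ᵀ).trace = a ⬝ᵥ K *ᵥ a := by
        rw [dotProduct_mulVec]
        simp [trace, Matrix.mul_apply, dotProduct, vecMul]
      rw [h2, h3] at h1
      rw [← h1]
      refine lintegral_congr_ae ?_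
      filter_upwards [h.2] with z hz
      rw [hz]
    have h3 := (e h).symm.trans (e h')
    have nn : ∀ {m : ι → ℝ} {K : Matrix ι ι ℝ}, K.PosDef →
        0 ≤ a ⬝ᵥ K *ᵥ a + (a ⬝ᵥ m + b) ^ 2 := fun hK =>
      add_nonneg (by simpa using hK.posSemidef.dotProduct_mulVec_nonneg a) (sq_nonneg _)
    rwa [ENNReal.ofReal_eq_ofReal_iff (nn h.1) (nn h'.1)] at h3
  have hm : ∀ a : ι → ℝ, a ⬝ᵥ m = a ⬝ᵥ m' := fun a => by
    have h1 := key a 1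
    have h2 := key a (-1)
    linarith
  have hK : ∀ a : ι → ℝ, a ⬝ᵥ K *ᵥ a = a ⬝ᵥ K' *ᵥ a := fun a => by
    have h1 := key a 0
    rw [hm a] at h1
    linarith
  refine ⟨funext fun i => by simpa using hm (Pi.single i 1), ?_⟩
  have hsym : ∀ {K : Matrix ι ι ℝ}, K.PosDef → ∀ i j, K j i = K i j := fun hK i j => by
    simpa using hK.1.apply i j
  ext i j
  have hi := hK (Pi.single i 1)
  have hj := hK (Pi.single j 1)
  have hij := hK (Pi.single i 1 + Pi.single j 1)
  simp [mulVec_add, add_dotProduct, dotProduct_add] at hi hj hij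
  rw [hsym h.1 i j, hsym h'.1 i j] at hij
  linarith

end Gaussian

/-! ### Block Gaussian laws: regression, conditioning and the optimality of the conditional mean -/

section Block

variable {ι κ : Type*} [Fintype ι] [Fintype κ]

/-- Integration over a product, with the second factor outside. -/
theorem lintegral_sum (F : (ι ⊕ κ → ℝ) → ℝ≥0∞) (hF : Measurable F) :
    ∫⁻ z, F z = ∫⁻ y : κ → ℝ, ∫⁻ x : ι → ℝ, F (Sum.elim x y) := by
  have h := (volume_measurePreserving_sumPiEquivProdPi_symm fun _ : ι ⊕ κ => ℝ)
  rw [← h.lintegral_comp hF, Measure.volume_eq_prod, lintegral_prod_symm']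
  · refine lintegral_congr fun y => lintegral_congr fun x => congrArg F ?_
    ext (i | i) <;> rfl
  · exact hF.comp (MeasurableEquiv.measurable _)

/-- A square factor of a block covariance with regression matrix `G`. -/
def blockFactor (S : Matrix ι ι ℝ) (G : Matrix ι κ ℝ) (R : Matrix κ κ ℝ) :
    Matrix (ι ⊕ κ) (ι ⊕ κ) ℝ :=
  fromBlocks S (G * R) 0 R

/-- The covariance of `(G y + e, y)` for independent `e` and `y` with covariances `X` and `Y`. -/
def regressionCov (X : Matrix ι ι ℝ) (G : Matrix ι κ ℝ) (Y : Matrix κ κ ℝ) :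
    Matrix (ι ⊕ κ) (ι ⊕ κ) ℝ :=
  fromBlocks (X + G * Y * Gᵀ) (G * Y) (Y * Gᵀ) Y

variable [DecidableEq ι]

/-- The residual covariance `X` is the congruence of the joint covariance by the injective map `[1,
-G]`; it is the Schur complement of `Y`. -/
theorem PosDef.of_regressionCov {X : Matrix ι ι ℝ} {G : Matrix ι κ ℝ}
    {Y : Matrix κ κ ℝ} (h : (regressionCov X G Y).PosDef) : X.PosDef ∧ Y.PosDef := by
  constructor
  · have hinj : Function.Injective (fromCols (1 : Matrix ι ι ℝ) (-G)).vecMul := by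
      intro v w hvw
      funext i
      simpa [vecMul_fromCols] using congrFun hvw (Sum.inl i)
    have h1 := h.mul_mul_conjTranspose_same hinj
    have h2 : fromCols (1 : Matrix ι ι ℝ) (-G) * regressionCov X G Y *
        (fromCols (1 : Matrix ι ι ℝ) (-G))ᴴ = X := by
      rw [conjTranspose_eq_transpose_of_trivial, transpose_fromCols, regressionCov,
        fromCols_mul_fromBlocks, fromCols_mul_fromRows]
      simp [Matrix.mul_assoc]
    rwa [h2] at h1
  · exact h.submatrix (e := Sum.inr) Sum.inr_injective

variable [DecidableEq κ]

/-- Distorting only the first block of whitened coordinates alters the residual covariance and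
leaves the regression matrix and the second marginal untouched. This is why the worst-case law keeps
the nominal gain. -/
theorem blockFactor_mul_diagonal_mul_transpose (S : Matrix ι ι ℝ) (G : Matrix ι κ ℝ)
    (R : Matrix κ κ ℝ) (d : ι → ℝ) :
    blockFactor S G R * diagonal (Sum.elim d fun _ => 1) * (blockFactor S G R)ᵀ =
      regressionCov (S * diagonal d * Sᵀ) G (R * Rᵀ) := by
  have e : diagonal (Sum.elim d fun _ : κ => (1 : ℝ)) = fromBlocks (diagonal d) 0 0 1 := by
    rw [← diagonal_one, fromBlocks_diagonal]
  rw [e, blockFactor, regressionCov, fromBlocks_transpose, fromBlocks_multiply,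
    fromBlocks_multiply]
  simp [Matrix.mul_assoc]

theorem isUnit_blockFactor {S : Matrix ι ι ℝ} (hS : IsUnit S) (G : Matrix ι κ ℝ)
    {R : Matrix κ κ ℝ} (hR : IsUnit R) : IsUnit (blockFactor S G R) :=
  isUnit_fromBlocks_zero₂₁.2 ⟨hS, hR⟩

theorem posDef_regressionCov {X : Matrix ι ι ℝ} (hX : X.PosDef) (G : Matrix ι κ ℝ)
    {Y : Matrix κ κ ℝ} (hY : Y.PosDef) : (regressionCov X G Y).PosDef := by
  obtain ⟨S, hS, rfl⟩ := exists_isUnit_mul_transpose hX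
  obtain ⟨R, hR, rfl⟩ := exists_isUnit_mul_transpose hY
  have := posDef_mul_diagonal_mul_transpose (isUnit_blockFactor hS G hR)
    (d := Sum.elim (fun _ => 1) fun _ => 1) (by rintro (i | i) <;> simp)
  rwa [blockFactor_mul_diagonal_mul_transpose, diagonal_one, Matrix.mul_one] at this

theorem gaussPdf_fromBlocks_diagonal {X : Matrix ι ι ℝ} (hX : X.PosDef) {Y : Matrix κ κ ℝ}
    (hY : Y.PosDef) (a x : ι → ℝ) (b y : κ → ℝ) :
    gaussPdf (Sum.elim a b) (fromBlocks X 0 0 Y) (Sum.elim x y) =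
      gaussPdf a X x * gaussPdf b Y y := by
  have hinv : (fromBlocks X 0 0 Y)⁻¹ = fromBlocks X⁻¹ 0 0 Y⁻¹ := by
    apply inv_eq_right_inv
    rw [fromBlocks_multiply]
    simp [mul_nonsing_inv _ hX.det_pos.ne'.isUnit, mul_nonsing_inv _ hY.det_pos.ne'.isUnit]
  have hsub : Sum.elim x y - Sum.elim a b = Sum.elim (x - a) (y - b) := by
    ext (i | i) <;> rfl
  unfold gaussPdf
  rw [hinv, hsub, det_fromBlocks_zero₂₁, fromBlocks_mulVec]
  simp only [Sum.elim_comp_inl, Sum.elim_comp_inr, zero_mulVec, add_zero, zero_add,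
    sumElim_dotProduct_sumElim, Fintype.card_sum]
  rw [mul_mul_mul_comm, ← Real.exp_add, ← mul_inv, ← Real.sqrt_mul
    (mul_nonneg (by positivity) hX.det_pos.le), mul_add, pow_add, mul_mul_mul_comm]

/-- A Gaussian density on a product factors into a marginal and a conditional density. -/
theorem gaussPdf_regressionCov {X : Matrix ι ι ℝ} (hX : X.PosDef) (G : Matrix ι κ ℝ)
    {Y : Matrix κ κ ℝ} (hY : Y.PosDef) (a x : ι → ℝ) (b y : κ → ℝ) :
    gaussPdf (Sum.elim a b) (regressionCov X G Y) (Sum.elim x y) =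
      gaussPdf b Y y * gaussPdf (a + G *ᵥ (y - b)) X x := by
  -- This shear of determinant one adds `G y` to the first component; before it the two components
  -- are independent.
  have hS : IsUnit (blockFactor (1 : Matrix ι ι ℝ) G (1 : Matrix κ κ ℝ)) :=
    isUnit_blockFactor isUnit_one G isUnit_one
  have hvec : ∀ (u : ι → ℝ) (v : κ → ℝ), blockFactor 1 G 1 *ᵥ Sum.elim (u - G *ᵥ v) v =
      Sum.elim u v := fun u v => by
    rw [blockFactor, fromBlocks_mulVec]
    simp
  have hcov : blockFactor 1 G 1 * fromBlocks X 0 0 Y * (blockFactor 1 G 1)ᵀ =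
      regressionCov X G Y := by
    rw [blockFactor, regressionCov, fromBlocks_transpose, fromBlocks_multiply,
      fromBlocks_multiply]
    simp [Matrix.mul_assoc]
  have hdet : (blockFactor (1 : Matrix ι ι ℝ) G (1 : Matrix κ κ ℝ)).det = 1 := by
    simp [blockFactor]
  have h := gaussPdf_affine hS (Sum.elim (a - G *ᵥ b) b) 0 (fromBlocks X 0 0 Y)
    (Sum.elim (x - G *ᵥ y) y)
  rw [hvec, hvec, hcov, hdet, zero_add, zero_add, abs_one, inv_one, one_mul,
    gaussPdf_fromBlocks_diagonal hX hY, mul_comm] at h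
  rw [h]
  congr 1
  unfold gaussPdf
  have : x - G *ᵥ y - (a - G *ᵥ b) = x - (a + G *ᵥ (y - b)) := by
    rw [mulVec_sub]; abel
  rw [this]

theorem gaussPdf_submatrix (e : ι ≃ κ) (m : κ → ℝ) (K : Matrix κ κ ℝ) (z : κ → ℝ) :
    gaussPdf (m ∘ e) (K.submatrix e e) (z ∘ e) = gaussPdf m K z := by
  unfold gaussPdf
  have : z ∘ e - m ∘ e = (z - m) ∘ e := rfl
  rw [det_submatrix_equiv_self, Fintype.card_congr e, inv_submatrix_equiv, this,
    submatrix_mulVec_equiv, Function.comp_assoc, e.self_comp_symm, Function.comp_id,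
    comp_equiv_dotProduct_comp_equiv]

/-- The law of `M x + w` for independent Gaussian `x` and `w`. -/
theorem lintegral_gaussPdf_mul_gaussPdf {R : Matrix ι ι ℝ} (hR : R.PosDef) (M : Matrix ι κ ℝ)
    {V : Matrix κ κ ℝ} (hV : V.PosDef) (b : κ → ℝ) (z : ι → ℝ) :
    ∫⁻ x, ENNReal.ofReal (gaussPdf (M *ᵥ x) R z * gaussPdf b V x) =
      ENNReal.ofReal (gaussPdf (M *ᵥ b) (M * V * Mᵀ + R) z) := by
  have hsymV : Vᵀ = V := by simpa using hV.1.eq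
  set K := M * V * Mᵀ + R
  have hreg := posDef_regressionCov hR M hV
  have hK : K.PosDef := by
    have := hreg.submatrix (e := Sum.inl) Sum.inl_injective
    have e : (regressionCov R M V).submatrix Sum.inl Sum.inl = K := by
      ext i j
      simp [regressionCov, K, add_comm]
    rwa [e] at this
  have hKu : IsUnit K.det := hK.det_pos.ne'.isUnit
  have hsymK : Kᵀ = K := by simpa using hK.1.eq
  -- `H` is the regression matrix of `x` on `z`. Factoring the joint density in the other order
  -- makes the integrand a density of `z` times a normalized density in `x`.
  set H := V * Mᵀ * K⁻¹
  have hHK : H * K = V * Mᵀ := by simp [H, Matrix.mul_assoc, nonsing_inv_mul _ hKu]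
  have hKH : K * Hᵀ = M * V := by
    rw [← hsymK, ← transpose_mul, hHK, transpose_mul, hsymV, transpose_transpose]
  have hswap : (regressionCov R M V).submatrix (Equiv.sumComm κ ι) (Equiv.sumComm κ ι) =
      regressionCov (V - H * K * Hᵀ) H K := by
    rw [regressionCov, regressionCov, hHK, hKH, sub_add_cancel]
    simp [K, add_comm]
  have hX : (V - H * K * Hᵀ).PosDef :=
    (PosDef.of_regressionCov (hswap ▸ hreg.submatrix (Equiv.injective _))).1
  have key : ∀ x, gaussPdf (M *ᵥ x) R z * gaussPdf b V x =
      gaussPdf (M *ᵥ b) K z * gaussPdf (b + H *ᵥ (z - M *ᵥ b)) (V - H * K * Hᵀ) x := by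
    intro x
    rw [← gaussPdf_regressionCov hX H hK, ← hswap, mul_comm]
    have h1 := gaussPdf_regressionCov hR M hV (M *ᵥ b) z b x
    rw [mulVec_sub, add_sub_cancel] at h1
    rw [← h1, ← gaussPdf_submatrix (Equiv.sumComm κ ι)]
    congr 1
    · ext (i | i) <;> rfl
    · ext (i | i) <;> rfl
  simp only [key, ENNReal.ofReal_mul (gaussPdf_nonneg _ _ _)]
  rw [lintegral_const_mul _ (continuous_gaussPdf _ _).measurable.ennreal_ofReal,
    lintegral_gaussPdf hX, mul_one]

/-- The mean square error of any estimator of the first component is at least that of the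
conditional mean. -/
theorem trace_le_lintegral_sqNorm {X : Matrix ι ι ℝ} (hX : X.PosDef) (G : Matrix ι κ ℝ)
    {Y : Matrix κ κ ℝ} (hY : Y.PosDef) (a : ι → ℝ) (b : κ → ℝ) {g : (κ → ℝ) → ι → ℝ}
    (hg : Measurable g) :
    ENNReal.ofReal X.trace ≤ ∫⁻ z : ι ⊕ κ → ℝ,
      ENNReal.ofReal (sqNorm (z ∘ Sum.inl - g (z ∘ Sum.inr))) *
        ENNReal.ofReal (gaussPdf (Sum.elim a b) (regressionCov X G Y) z) := by
  rw [lintegral_sum]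
  -- For fixed `y` the conditional second moment about `g y` is `X.trace` plus the squared distance
  -- of `g y` from the conditional mean.
  · have hin : ∀ y : κ → ℝ, ENNReal.ofReal (gaussPdf b Y y) * ENNReal.ofReal X.trace ≤
        ∫⁻ x : ι → ℝ, ENNReal.ofReal (sqNorm (Sum.elim x y ∘ Sum.inl -
          g (Sum.elim x y ∘ Sum.inr))) *
        ENNReal.ofReal (gaussPdf (Sum.elim a b) (regressionCov X G Y) (Sum.elim x y)) := by
      intro y
      have e : ∀ x : ι → ℝ, ENNReal.ofReal (sqNorm (Sum.elim x y ∘ Sum.inl -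
          g (Sum.elim x y ∘ Sum.inr))) *
          ENNReal.ofReal (gaussPdf (Sum.elim a b) (regressionCov X G Y) (Sum.elim x y)) =
          ENNReal.ofReal (gaussPdf b Y y) * (ENNReal.ofReal (sqNorm ((1 : Matrix ι ι ℝ) *ᵥ x + -g y))
            * ENNReal.ofReal (gaussPdf (a + G *ᵥ (y - b)) X x)) := by
        intro x
        rw [gaussPdf_regressionCov hX G hY, ENNReal.ofReal_mul (gaussPdf_nonneg _ _ _),
          Sum.elim_comp_inl, Sum.elim_comp_inr, one_mulVec, ← sub_eq_add_neg, mul_left_comm]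
      simp only [e]
      rw [lintegral_const_mul' _ _ ENNReal.ofReal_ne_top, lintegral_sqNorm_gaussPdf hX]
      refine mul_le_mul_right (ENNReal.ofReal_le_ofReal ?_) _
      rw [Matrix.one_mul, transpose_one, Matrix.mul_one]
      exact le_add_of_nonneg_right (sqNorm_nonneg _)
    refine le_trans (le_of_eq ?_) (lintegral_mono hin)
    rw [lintegral_mul_const _ (continuous_gaussPdf _ _).measurable.ennreal_ofReal,
      lintegral_gaussPdf hY, one_mul]
  · refine Measurable.mul ?_ (continuous_gaussPdf _ _).measurable.ennreal_ofReal
    refine (continuous_sqNorm.measurable.comp (Measurable.sub ?_ (hg.comp ?_))).ennreal_ofReal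
    · exact measurable_pi_lambda _ fun i => measurable_pi_apply _
    · exact measurable_pi_lambda _ fun i => measurable_pi_apply _

end Block

/-! ### The divergence in whitened coordinates and Klein's inequality -/

section Divergence

variable {ι κ : Type*} [Fintype ι] [DecidableEq ι] [Fintype κ] [DecidableEq κ]

/-- Two square factors of the same matrix differ by an orthogonal matrix. -/
theorem exists_orthogonal_of_mul_transpose_eq {L T : Matrix ι ι ℝ} (hL : IsUnit L)
    (h : L * Lᵀ = T * Tᵀ) : ∃ O : Matrix ι ι ℝ, O * Oᵀ = 1 ∧ L * O = T := by
  have hd := (isUnit_iff_isUnit_det L).1 hL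
  refine ⟨L⁻¹ * T, ?_, by rw [← Matrix.mul_assoc, mul_nonsing_inv _ hd, Matrix.one_mul]⟩
  calc L⁻¹ * T * (L⁻¹ * T)ᵀ = L⁻¹ * (T * Tᵀ) * (Lᵀ)⁻¹ := by
        rw [transpose_mul, transpose_nonsing_inv]; simp only [Matrix.mul_assoc]
    _ = 1 := by
        rw [← h, ← Matrix.mul_assoc, nonsing_inv_mul _ hd, Matrix.one_mul,
          mul_nonsing_inv _ (by rwa [det_transpose])]

theorem isUnit_of_mul_transpose_posDef {L : Matrix ι ι ℝ} (h : (L * Lᵀ).PosDef) : IsUnit L := by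
  rw [isUnit_iff_isUnit_det, isUnit_iff_ne_zero]
  intro h0
  have := h.det_pos
  rw [det_mul, h0, zero_mul] at this
  exact lt_irrefl _ this

theorem matSqrt_mul_transpose {K : Matrix ι ι ℝ} (hK : K.PosDef) :
    matSqrt K * (matSqrt K)ᵀ = K := by
  obtain ⟨U, d, hU, hd, rfl⟩ := exists_orthogonal_diagonal_of_posDef hK
  have hs : matSqrt (U * diagonal d * Uᵀ) = U * diagonal (fun i => Real.sqrt (d i)) * Uᵀ :=
    cfc_orthogonal_diagonal Real.sqrt hU d
  have hO : Uᵀ * (Uᵀ)ᵀ = 1 := by rw [transpose_transpose, transpose_mul_self_of_orthogonal hU]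
  rw [hs, transpose_mul, Matrix.mul_assoc, ← Matrix.mul_assoc Uᵀ, hO, Matrix.one_mul,
    mul_diagonal_mul_transpose]
  simp only [fun i => Real.mul_self_sqrt (hd i).le]

theorem dotProduct_inv_mulVec_eq_sqNorm {T : Matrix ι ι ℝ} (v : ι → ℝ) :
    v ⬝ᵥ ((T * Tᵀ)⁻¹ *ᵥ v) = sqNorm (T⁻¹ *ᵥ v) := by
  rw [Matrix.mul_inv_rev, ← mulVec_mulVec, ← transpose_nonsing_inv, dotProduct_mulVec,
    vecMul_transpose]
  simp [sqNorm, dotProduct, sq]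

/-- The `τ`-divergence in terms of a simultaneous diagonalization of the two covariances. -/
theorem tauDiv_eq (τ : ℝ) (m' m : ι → ℝ) {T : Matrix ι ι ℝ} (hT : IsUnit T) {e : ι → ℝ} :
    tauDiv τ m' (T * diagonal e * Tᵀ) m (T * Tᵀ) =
      if τ = 1 then (if m' = m then 0 else ⊤) + ((∑ i, scalarDiv τ (e i) : ℝ) : EReal)
      else ((1 / (1 - τ) * ((m' - m) ⬝ᵥ ((T * Tᵀ)⁻¹ *ᵥ (m' - m))) +
        ∑ i, scalarDiv τ (e i) : ℝ) : EReal) := by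
  have hd := (isUnit_iff_isUnit_det T).1 hT
  have hd' : IsUnit Tᵀ.det := by rwa [det_transpose]
  have hK : (T * Tᵀ).PosDef := by
    have := posDef_mul_diagonal_mul_transpose hT (d := fun _ => 1) fun _ => one_pos
    rwa [diagonal_one, Matrix.mul_one] at this
  have hL2 := matSqrt_mul_transpose hK
  have hLu : IsUnit (matSqrt (T * Tᵀ)) := isUnit_of_mul_transpose_posDef (by rw [hL2]; exact hK)
  -- Whitening by the symmetric root instead of `T` changes the normalized covariance only by an
  -- orthogonal conjugation.
  obtain ⟨O, hO, hLO⟩ := exists_orthogonal_of_mul_transpose_eq hLu hL2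
  have hLd := (isUnit_iff_isUnit_det _).1 hLu
  have hE : (matSqrt (T * Tᵀ))⁻¹ * (T * diagonal e * Tᵀ) * ((matSqrt (T * Tᵀ))⁻¹)ᵀ =
      O * diagonal e * Oᵀ := by
    have hinv : (matSqrt (T * Tᵀ))⁻¹ * T = O := by
      calc (matSqrt (T * Tᵀ))⁻¹ * T = (matSqrt (T * Tᵀ))⁻¹ * (matSqrt (T * Tᵀ) * O) := by rw [hLO]
        _ = O := by rw [← Matrix.mul_assoc, nonsing_inv_mul _ hLd, Matrix.one_mul]
    calc _ = ((matSqrt (T * Tᵀ))⁻¹ * T) * diagonal e * ((matSqrt (T * Tᵀ))⁻¹ * T)ᵀ := by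
          rw [transpose_mul]; simp only [Matrix.mul_assoc]
      _ = _ := by rw [hinv]
  have htr : (T * diagonal e * Tᵀ * (T * Tᵀ)⁻¹).trace = ∑ i, e i := by
    rw [Matrix.mul_inv_rev, ← Matrix.mul_assoc, Matrix.mul_assoc (T * diagonal e),
      mul_nonsing_inv _ hd', Matrix.mul_one, trace_mul_comm, ← Matrix.mul_assoc,
      nonsing_inv_mul _ hd, Matrix.one_mul, trace_diagonal]
  unfold tauDiv
  simp only [hE, matLog, matPow, cfc_orthogonal_diagonal _ hO]
  by_cases h0 : τ = 0
  · subst h0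
    simp only [if_true, zero_ne_one, if_false]
    rw [trace_sub, trace_add, trace_neg, htr, trace_orthogonal_diagonal hO, trace_one]
    simp [scalarDiv, Finset.sum_add_distrib, Finset.sum_sub_distrib]
  by_cases h1 : τ = 1
  · subst h1
    simp only [if_true, one_ne_zero, if_false]
    have hmul : O * diagonal e * Oᵀ * (O * diagonal (fun i => Real.log (e i)) * Oᵀ) =
        O * diagonal (fun i => e i * Real.log (e i)) * Oᵀ := by
      rw [← diagonal_mul_diagonal]
      calc _ = O * diagonal e * (Oᵀ * O) * diagonal (fun i => Real.log (e i)) * Oᵀ := by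
            simp only [Matrix.mul_assoc]
        _ = _ := by
            rw [transpose_mul_self_of_orthogonal hO, Matrix.mul_one]; simp only [Matrix.mul_assoc]
    rw [hmul, trace_add, trace_sub, htr, trace_orthogonal_diagonal hO, trace_one]
    simp [scalarDiv, Finset.sum_add_distrib, Finset.sum_sub_distrib]
  · simp only [h0, h1, if_false]
    rw [trace_add, trace_add, trace_smul, trace_smul, trace_smul, htr,
      trace_orthogonal_diagonal hO, trace_one]
    refine congrArg Real.toEReal ?_
    simp only [scalarDiv, h0, h1, if_false, Finset.sum_add_distrib, ← Finset.mul_sum,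
      Finset.sum_const, Finset.card_univ, nsmul_eq_mul, smul_eq_mul]
    ring

/-- Klein's trace inequality for the convex function `scalarDiv τ`, at a diagonal matrix. -/
theorem sum_scalarDiv_tangent {τ : ℝ} (hτ0 : 0 ≤ τ) (hτ1 : τ ≤ 1) {U : Matrix ι ι ℝ}
    (hU : U * Uᵀ = 1) {e y : ι → ℝ} (he : ∀ i, 0 < e i) (hy : ∀ j, (1 - τ) * y j < 1) :
    ∑ j, (scalarDiv τ (tilt τ (y j)) + y j * ((U * diagonal e * Uᵀ) j j - tilt τ (y j))) ≤
      ∑ i, scalarDiv τ (e i) := by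
  -- The squared entries of `U` are doubly stochastic: diagonal entries of `U * diagonal e * Uᵀ` are
  -- weighted averages of the eigenvalues, and the scalar tangent inequality is averaged with these
  -- weights.
  have hrow : ∀ j, ∑ i, U j i ^ 2 = 1 := fun j => by
    have := congrFun (congrFun hU j) j
    simpa [Matrix.mul_apply, sq] using this
  have hcol : ∀ i, ∑ j, U j i ^ 2 = 1 := fun i => by
    have := congrFun (congrFun (transpose_mul_self_of_orthogonal hU) i) i
    simpa [Matrix.mul_apply, sq] using this
  have hdiag : ∀ j, (U * diagonal e * Uᵀ) j j = ∑ i, U j i ^ 2 * e i := fun j => by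
    rw [Matrix.mul_apply]
    refine Finset.sum_congr rfl fun i _ => ?_
    rw [mul_diagonal, transpose_apply]; ring
  calc ∑ j, (scalarDiv τ (tilt τ (y j)) + y j * ((U * diagonal e * Uᵀ) j j - tilt τ (y j)))
      = ∑ j, ∑ i, U j i ^ 2 * (scalarDiv τ (tilt τ (y j)) + y j * (e i - tilt τ (y j))) := by
        refine Finset.sum_congr rfl fun j _ => ?_
        have e1 : ∀ i, U j i ^ 2 * (scalarDiv τ (tilt τ (y j)) + y j * (e i - tilt τ (y j))) =
            U j i ^ 2 * (scalarDiv τ (tilt τ (y j)) - y j * tilt τ (y j)) +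
              y j * (U j i ^ 2 * e i) := fun i => by ring
        simp only [e1]
        rw [Finset.sum_add_distrib, ← Finset.sum_mul, ← Finset.mul_sum, hrow, hdiag]
        ring
    _ ≤ ∑ j, ∑ i, U j i ^ 2 * scalarDiv τ (e i) :=
        Finset.sum_le_sum fun j _ => Finset.sum_le_sum fun i _ =>
          mul_le_mul_of_nonneg_left (scalarDiv_tangent hτ0 hτ1 (he i) (hy j)) (sq_nonneg _)
    _ = ∑ i, scalarDiv τ (e i) := by
        rw [Finset.sum_comm]
        refine Finset.sum_congr rfl fun i _ => ?_
        rw [← Finset.sum_mul, hcol, one_mul]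

/-- The linear functional in the worst-case error is bounded on the divergence ball. -/
theorem sum_mul_add_le_of_tauDiv_le {τ θ c : ℝ} (hτ0 : 0 ≤ τ) (hτ1 : τ ≤ 1) (hθ : 0 < θ)
    {q : ι → ℝ} (hq : ∀ i, (1 - τ) * (θ * q i) < 1)
    (hc : ∑ i, scalarDiv τ (tilt τ (θ * q i)) = c) {T : Matrix (ι ⊕ κ) (ι ⊕ κ) ℝ} (hT : IsUnit T)
    {E : Matrix (ι ⊕ κ) (ι ⊕ κ) ℝ} (hE : E.PosDef) {m m' : ι ⊕ κ → ℝ}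
    (h : tauDiv τ m' (T * E * Tᵀ) m (T * Tᵀ) ≤ (c : EReal)) :
    ∑ i, q i * E (Sum.inl i) (Sum.inl i) + ∑ i, q i * (T⁻¹ *ᵥ (m' - m)) (Sum.inl i) ^ 2 ≤
      ∑ i, q i * tilt τ (θ * q i) := by
  obtain ⟨U, e, hU, he, rfl⟩ := exists_orthogonal_diagonal_of_posDef hE
  have hTU : IsUnit (T * U) := hT.mul (IsUnit.of_mul_eq_one _ hU)
  have e1 : T * (U * diagonal e * Uᵀ) * Tᵀ = (T * U) * diagonal e * (T * U)ᵀ := by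
    rw [transpose_mul]; simp only [Matrix.mul_assoc]
  have e2 : T * Tᵀ = (T * U) * (T * U)ᵀ := by
    rw [transpose_mul, Matrix.mul_assoc T, ← Matrix.mul_assoc U, hU, Matrix.one_mul]
  rw [e1, e2, tauDiv_eq τ m' m hTU, ← e2, dotProduct_inv_mulVec_eq_sqNorm] at h
  -- The slopes are `θ * q i` on the error block and `0` on the observation block, where the tangent
  -- point is `1` and contributes nothing.
  have hk := sum_scalarDiv_tangent hτ0 hτ1 hU (y := Sum.elim (fun i => θ * q i) fun _ => 0) he
    (by rintro (i | i)
        · exact hq i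
        · simp)
  rw [Fintype.sum_sum_type] at hk
  simp only [Sum.elim_inl, Sum.elim_inr, tilt_zero, scalarDiv_one, zero_mul, add_zero,
    Finset.sum_const_zero, Finset.sum_add_distrib, hc] at hk
  have hlin : ∑ i, θ * q i * ((U * diagonal e * Uᵀ) (Sum.inl i) (Sum.inl i) - tilt τ (θ * q i)) =
      θ * (∑ i, q i * (U * diagonal e * Uᵀ) (Sum.inl i) (Sum.inl i) -
        ∑ i, q i * tilt τ (θ * q i)) := by
    rw [← Finset.sum_sub_distrib, Finset.mul_sum]
    exact Finset.sum_congr rfl fun i _ => by ring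
  rw [hlin] at hk
  set w := T⁻¹ *ᵥ (m' - m)
  -- A mean shift costs at least `θ` times its gain: for `τ = 1` a nonzero shift has infinite
  -- divergence, and for `τ < 1` admissibility gives `θ * q i ≤ 1 / (1 - τ)`.
  have hmean : θ * ∑ i, q i * w (Sum.inl i) ^ 2 + ∑ i, scalarDiv τ (e i) ≤ c := by
    by_cases h1 : τ = 1
    · rw [if_pos h1] at h
      by_cases hm : m' = m
      · rw [if_pos hm, zero_add, EReal.coe_le_coe_iff] at h
        have hw : w = 0 := by simp [w, hm]
        simpa [hw] using h
      · rw [if_neg hm, EReal.top_add_coe, top_le_iff] at h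
        exact absurd h (EReal.coe_ne_top c)
    · rw [if_neg h1, EReal.coe_le_coe_iff] at h
      refine le_trans (add_le_add_left ?_ _) h
      have hs : 0 < 1 - τ := sub_pos.2 (lt_of_le_of_ne hτ1 h1)
      rw [one_div, inv_mul_eq_div, le_div_iff₀ hs, sqNorm, Fintype.sum_sum_type, Finset.mul_sum,
        Finset.sum_mul]
      refine le_trans (Finset.sum_le_sum fun i _ => ?_)
        (le_add_of_nonneg_right (Finset.sum_nonneg fun _ _ => sq_nonneg _))
      have := mul_le_mul_of_nonneg_right (hq i).le (sq_nonneg (w (Sum.inl i)))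
      linarith
  have := mul_le_mul_iff_right₀ hθ (b := ∑ i, q i * (U * diagonal e * Uᵀ) (Sum.inl i) (Sum.inl i) +
    ∑ i, q i * w (Sum.inl i) ^ 2) (c := ∑ i, q i * tilt τ (θ * q i))
  rw [← this, mul_add]
  linarith

end Divergence

/-! ### Eigenvalue form of the parameter equation and of the distortion -/

section Spectral

variable {ι : Type*} [Fintype ι] [DecidableEq ι]

theorem gt_specNorm_iff [Nonempty ι] {τ s : ℝ} (hτ1 : τ ≤ 1) {U : Matrix ι ι ℝ} (hU : U * Uᵀ = 1)
    {q : ι → ℝ} (hq : ∀ i, 0 < q i) :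
    s⁻¹ > (1 - τ) * specNorm (U * diagonal q * Uᵀ) ↔
      0 < s ∧ ∀ i, (1 - τ) * (s * q i) < 1 := by
  rw [specNorm_orthogonal_diagonal hU]
  have hτ : 0 ≤ 1 - τ := by linarith
  obtain ⟨j, hj⟩ := Finite.exists_max q
  have hn : ‖q‖ = q j := by
    refine le_antisymm ((pi_norm_le_iff_of_nonneg (hq j).le).2 fun i => ?_) ?_
    · rw [Real.norm_of_nonneg (hq i).le]; exact hj i
    · rw [← Real.norm_of_nonneg (hq j).le]; exact norm_le_pi_norm q j
  rw [hn, gt_iff_lt]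
  constructor
  · intro h
    -- The bound is nonnegative, so `s⁻¹` is positive; this also rules out `s = 0`, where `s⁻¹ = 0`
    -- by convention.
    have hs : 0 < s := inv_pos.1 (lt_of_le_of_lt (mul_nonneg hτ (hq j).le) h)
    refine ⟨hs, fun i => ?_⟩
    have h1 : (1 - τ) * q i < s⁻¹ := lt_of_le_of_lt (mul_le_mul_of_nonneg_left (hj i) hτ) h
    have h2 := mul_lt_mul_of_pos_left h1 hs
    rw [mul_inv_cancel₀ hs.ne'] at h2
    linarith
  · rintro ⟨hs, h⟩
    have := h j
    rw [← one_div, lt_div_iff₀ hs]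
    linarith

variable {L U : Matrix ι ι ℝ} {q : ι → ℝ}

/-- `L` and `U * diagonal √q` are factors of the same matrix, so they differ by an orthogonal `O`.
Hence `Lᵀ * L` has the eigenvalues `q` for every `L`, the source of all independence of the factor.
-/
theorem transpose_mul_self_eq (hU : U * Uᵀ = 1) (hq : ∀ i, 0 < q i)
    (hL : U * diagonal q * Uᵀ = L * Lᵀ) :
    ∃ O : Matrix ι ι ℝ, O * Oᵀ = 1 ∧ L * O = U * diagonal (fun i => Real.sqrt (q i)) ∧
      Lᵀ * L = O * diagonal q * Oᵀ := by
  have hLu : IsUnit L := isUnit_of_mul_transpose_posDef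
    (hL ▸ posDef_mul_diagonal_mul_transpose (IsUnit.of_mul_eq_one _ hU) hq)
  have hsq : (fun i => Real.sqrt (q i) * Real.sqrt (q i)) = q :=
    funext fun i => Real.mul_self_sqrt (hq i).le
  obtain ⟨O, hO, hLO⟩ := exists_orthogonal_of_mul_transpose_eq hLu
    (T := U * diagonal fun i => Real.sqrt (q i)) (by rw [mul_diagonal_mul_transpose, hsq, hL])
  refine ⟨O, hO, hLO, ?_⟩
  have hL' : L = U * diagonal (fun i => Real.sqrt (q i)) * Oᵀ := by
    rw [← hLO, Matrix.mul_assoc, hO, Matrix.mul_one]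
  have hU' := transpose_mul_self_of_orthogonal hU
  calc Lᵀ * L = O * (diagonal (fun i => Real.sqrt (q i)) * (Uᵀ * U) *
        diagonal (fun i => Real.sqrt (q i))) * Oᵀ := by
        rw [hL']
        simp only [transpose_mul, transpose_transpose, diagonal_transpose, Matrix.mul_assoc]
    _ = _ := by rw [hU', Matrix.mul_one, diagonal_mul_diagonal, hsq]

theorem one_sub_smul_orthogonal_diagonal (hU : U * Uᵀ = 1) (a : ℝ) (q : ι → ℝ) :
    1 - a • (U * diagonal q * Uᵀ) = U * diagonal (fun i => 1 - a * q i) * Uᵀ := by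
  have : diagonal (fun i => 1 - a * q i) = 1 - a • diagonal q := by
    rw [← diagonal_one, ← diagonal_smul, ← diagonal_sub]
    rfl
  rw [this, Matrix.mul_sub, Matrix.sub_mul, Matrix.mul_one, hU, Matrix.mul_smul, Matrix.smul_mul]

theorem inv_orthogonal_diagonal (hU : U * Uᵀ = 1) (hq : ∀ i, q i ≠ 0) :
    (U * diagonal q * Uᵀ)⁻¹ = U * diagonal (fun i => (q i)⁻¹) * Uᵀ := by
  apply inv_eq_right_inv
  calc U * diagonal q * Uᵀ * (U * diagonal (fun i => (q i)⁻¹) * Uᵀ)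
      = U * (diagonal q * (Uᵀ * U) * diagonal fun i => (q i)⁻¹) * Uᵀ := by
        simp only [Matrix.mul_assoc]
    _ = 1 := by
        rw [transpose_mul_self_of_orthogonal hU, Matrix.mul_one, diagonal_mul_diagonal]
        simp only [fun i => mul_inv_cancel₀ (hq i), diagonal_one, Matrix.mul_one, hU]

theorem det_orthogonal_diagonal (hU : U * Uᵀ = 1) (q : ι → ℝ) :
    (U * diagonal q * Uᵀ).det = ∏ i, q i := by
  rw [det_mul_comm, ← Matrix.mul_assoc, transpose_mul_self_of_orthogonal hU, Matrix.one_mul,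
    det_diagonal]

/-- In each case `γ_τ` is the trace of `d ∘ h` applied to `s Lᵀ L`, or to `s L Lᵀ` when `τ = 0`; the
exponent `τ / (τ - 1)` produces the `τ`-th power of `h`. -/
theorem gammaTau_eq {τ s : ℝ} (hU : U * Uᵀ = 1) (hq : ∀ i, 0 < q i)
    (hL : U * diagonal q * Uᵀ = L * Lᵀ) (hs : ∀ i, (1 - τ) * (s * q i) < 1) :
    gammaTau τ L s = ∑ i, scalarDiv τ (tilt τ (s * q i)) := by
  obtain ⟨O, hO, -, hLL⟩ := transpose_mul_self_eq hU hq hL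
  unfold gammaTau
  by_cases h0 : τ = 0
  · subst h0
    have hpos : ∀ i, 0 < 1 - s * q i := fun i => by have := hs i; linarith
    have htilt : ∀ i, tilt 0 (s * q i) = (1 - s * q i)⁻¹ := fun i => by
      simp only [tilt]; norm_num [Real.rpow_neg_one]
    rw [if_pos rfl, ← hL, one_sub_smul_orthogonal_diagonal hU,
      inv_orthogonal_diagonal hU fun i => (hpos i).ne', det_orthogonal_diagonal hU, trace_sub,
      trace_orthogonal_diagonal hU, trace_one, Real.log_prod fun i _ => (inv_pos.2 (hpos i)).ne']
    simp [htilt, scalarDiv, Finset.sum_add_distrib, Finset.sum_sub_distrib]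
    ring
  by_cases h1 : τ = 1
  · subst h1
    have hsm : s • (O * diagonal q * Oᵀ) = O * diagonal (fun i => s * q i) * Oᵀ := by
      rw [← Matrix.smul_mul, ← Matrix.mul_smul, ← diagonal_smul]; rfl
    have hm1 : O * diagonal (fun i => s * q i) * Oᵀ - 1 =
        O * diagonal (fun i => s * q i - 1) * Oᵀ := by
      have : diagonal (fun i => s * q i - 1) = diagonal (fun i => s * q i) - 1 := by
        rw [← diagonal_one, ← diagonal_sub]
      rw [this, Matrix.mul_sub, Matrix.sub_mul, Matrix.mul_one, hO]
    have hmul : O * diagonal (fun i => Real.exp (s * q i)) * Oᵀ *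
        (O * diagonal (fun i => s * q i - 1) * Oᵀ) =
        O * diagonal (fun i => Real.exp (s * q i) * (s * q i - 1)) * Oᵀ := by
      rw [← diagonal_mul_diagonal]
      calc _ = O * diagonal (fun i => Real.exp (s * q i)) * (Oᵀ * O) *
            diagonal (fun i => s * q i - 1) * Oᵀ := by simp only [Matrix.mul_assoc]
        _ = _ := by
            rw [transpose_mul_self_of_orthogonal hO, Matrix.mul_one]; simp only [Matrix.mul_assoc]
    rw [if_neg one_ne_zero, if_pos rfl, hLL, hsm, exp_orthogonal_diagonal hO, hm1, hmul, trace_add,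
      trace_orthogonal_diagonal hO, trace_one]
    simp [scalarDiv, tilt, Finset.sum_add_distrib, Finset.sum_sub_distrib, mul_sub]
  · have htilt : ∀ i, tilt τ (s * q i) = (1 - s * (1 - τ) * q i) ^ (1 / (τ - 1)) := fun i => by
      rw [tilt, if_neg h1]; congr 2; ring
    have hpow : ∀ i, (1 - s * (1 - τ) * q i) ^ (τ / (τ - 1)) = tilt τ (s * q i) ^ τ := fun i => by
      rw [htilt, ← Real.rpow_mul (by have := hs i; linarith)]
      congr 1; ring
    simp only [h0, h1, if_false, matPow, hLL, one_sub_smul_orthogonal_diagonal hO,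
      cfc_orthogonal_diagonal _ hO]
    rw [trace_add, trace_add, trace_smul, trace_smul, trace_smul, trace_one,
      trace_orthogonal_diagonal hO, trace_orthogonal_diagonal hO]
    simp only [hpow, ← htilt]
    simp [scalarDiv, h0, h1, Finset.sum_add_distrib, Finset.mul_sum, mul_comm]

/-- The right side does not involve `L`: the orthogonal matrix relating `L` to `U * diagonal √q` is
absorbed by the functional calculus. -/
theorem distortion_eq {τ s : ℝ} (hU : U * Uᵀ = 1) (hq : ∀ i, 0 < q i)
    (hL : U * diagonal q * Uᵀ = L * Lᵀ) :
    distortion τ L s = (U * diagonal fun i => Real.sqrt (q i)) *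
      diagonal (fun i => tilt τ (s * q i)) * (U * diagonal fun i => Real.sqrt (q i))ᵀ := by
  obtain ⟨O, hO, hLO, hLL⟩ := transpose_mul_self_eq hU hq hL
  rw [← hLO, transpose_mul]
  have hgen : ∀ d : ι → ℝ, L * (O * diagonal d * Oᵀ) * Lᵀ = L * O * diagonal d * (Oᵀ * Lᵀ) :=
    fun d => by simp only [Matrix.mul_assoc]
  unfold distortion
  split_ifs with h1
  · have hsm : s • (O * diagonal q * Oᵀ) = O * diagonal (fun i => s * q i) * Oᵀ := by
      rw [← Matrix.smul_mul, ← Matrix.mul_smul, ← diagonal_smul]; rfl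
    rw [hLL, hsm, exp_orthogonal_diagonal hO, hgen]
    simp only [tilt, h1, if_true]
  · rw [hLL, one_sub_smul_orthogonal_diagonal hO, matPow, cfc_orthogonal_diagonal _ hO, hgen]
    simp only [tilt, h1, if_false]
    congr 4
    ext i
    congr 2; ring

end Spectral

/-! ### The worst-case error of the nominal estimator -/

section WorstCase

variable {ι κ : Type*} [Fintype ι] [DecidableEq ι] [Fintype κ]

theorem sqNorm_mulVec_of_transpose_mul_self {S : Matrix ι ι ℝ} {q : ι → ℝ}
    (hS : Sᵀ * S = diagonal q) (u : ι → ℝ) : sqNorm (S *ᵥ u) = ∑ i, q i * u i ^ 2 := by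
  have h : sqNorm (S *ᵥ u) = (S *ᵥ u) ⬝ᵥ (S *ᵥ u) := by simp [sqNorm, dotProduct, sq]
  rw [h, dotProduct_mulVec, ← mulVec_transpose, mulVec_mulVec, hS, dotProduct]
  exact Finset.sum_congr rfl fun i _ => by rw [mulVec_diagonal]; ring

/-- In whitened coordinates the estimation error sees only the first block, through `S`. -/
theorem fromCols_one_neg_mul_blockFactor (S : Matrix ι ι ℝ) (G : Matrix ι κ ℝ)
    (R : Matrix κ κ ℝ) :
    fromCols (1 : Matrix ι ι ℝ) (-G) * blockFactor S G R = fromCols S 0 := by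
  rw [blockFactor, fromCols_mul_fromBlocks]
  simp

variable [DecidableEq κ]

/-- The mean square of the innovation error under a Gaussian law in the divergence ball. -/
theorem trace_add_sqNorm_le {τ θ c : ℝ} (hτ0 : 0 ≤ τ) (hτ1 : τ ≤ 1) (hθ : 0 < θ)
    {q : ι → ℝ} (hq : ∀ i, (1 - τ) * (θ * q i) < 1)
    (hc : ∑ i, scalarDiv τ (tilt τ (θ * q i)) = c) {S : Matrix ι ι ℝ} (hSu : IsUnit S)
    (hS : Sᵀ * S = diagonal q) (G : Matrix ι κ ℝ) {Y : Matrix κ κ ℝ} (hY : Y.PosDef)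
    {K' : Matrix (ι ⊕ κ) (ι ⊕ κ) ℝ} (hK' : K'.PosDef) {m m' : ι ⊕ κ → ℝ}
    (h : tauDiv τ m' K' m (regressionCov (S * Sᵀ) G Y) ≤ (c : EReal)) :
    (fromCols (1 : Matrix ι ι ℝ) (-G) * K' * (fromCols (1 : Matrix ι ι ℝ) (-G))ᵀ).trace +
      sqNorm (fromCols (1 : Matrix ι ι ℝ) (-G) *ᵥ (m' - m)) ≤ ∑ i, q i * tilt τ (θ * q i) := by
  obtain ⟨R, hR, rfl⟩ := exists_isUnit_mul_transpose hY
  set T := blockFactor S G R with hTdef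
  have hT : IsUnit T := isUnit_blockFactor hSu G hR
  have hTd := (isUnit_iff_isUnit_det T).1 hT
  have hTd' : IsUnit Tᵀ.det := by rwa [det_transpose]
  have hNT : fromCols (1 : Matrix ι ι ℝ) (-G) * T = fromCols S 0 :=
    fromCols_one_neg_mul_blockFactor S G R
  have hK : regressionCov (S * Sᵀ) G (R * Rᵀ) = T * Tᵀ := by
    have := blockFactor_mul_diagonal_mul_transpose S G R fun _ => 1
    rw [diagonal_one, Matrix.mul_one] at this
    rw [← this, show (Sum.elim (fun _ => 1) fun _ => 1 : ι ⊕ κ → ℝ) = fun _ => 1 by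
      ext (i | i) <;> rfl, diagonal_one, Matrix.mul_one]
  -- `E` is the perturbed covariance in coordinates where the nominal one is the identity; there the
  -- error is linear in the diagonal of its first block.
  set E := T⁻¹ * K' * (T⁻¹)ᵀ with hE
  have hEpos : E.PosDef := by
    have := hK'.mul_mul_conjTranspose_same (B := T⁻¹)
      (vecMul_injective_of_isUnit ((isUnit_nonsing_inv_iff).2 hT))
    rwa [conjTranspose_eq_transpose_of_trivial] at this
  have hKE : K' = T * E * Tᵀ := by
    rw [hE, transpose_nonsing_inv]
    calc K' = (T * T⁻¹) * K' * ((Tᵀ)⁻¹ * Tᵀ) := by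
          rw [mul_nonsing_inv _ hTd, nonsing_inv_mul _ hTd', Matrix.one_mul, Matrix.mul_one]
      _ = _ := by simp only [Matrix.mul_assoc]
  rw [hK, hKE] at h
  refine le_trans (le_of_eq ?_) (sum_mul_add_le_of_tauDiv_le hτ0 hτ1 hθ hq hc hT hEpos h)
  congr 1
  · have e1 : fromCols (1 : Matrix ι ι ℝ) (-G) * K' * (fromCols (1 : Matrix ι ι ℝ) (-G))ᵀ =
        fromCols S (0 : Matrix ι κ ℝ) * E * (fromCols S (0 : Matrix ι κ ℝ))ᵀ := by
      rw [hKE, ← hNT, transpose_mul]; simp only [Matrix.mul_assoc]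
    have e2 : fromCols S (0 : Matrix ι κ ℝ) * E * (fromCols S (0 : Matrix ι κ ℝ))ᵀ = S * E.toBlocks₁₁ * Sᵀ := by
      conv_lhs => rw [← fromBlocks_toBlocks E]
      rw [fromCols_mul_fromBlocks, transpose_fromCols, fromCols_mul_fromRows]
      simp
    rw [e1, e2, trace_mul_comm, ← Matrix.mul_assoc, hS, trace]
    refine Finset.sum_congr rfl fun i _ => ?_
    rw [diag_apply, diagonal_mul]
    rfl
  · have hv : m' - m = T *ᵥ (T⁻¹ *ᵥ (m' - m)) := by
      rw [mulVec_mulVec, mul_nonsing_inv _ hTd, one_mulVec]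
    conv_lhs => rw [hv]
    rw [mulVec_mulVec, hNT]
    set w := T⁻¹ *ᵥ (m' - m)
    have : fromCols S 0 *ᵥ w = S *ᵥ (w ∘ Sum.inl) := by
      rw [fromCols_mulVec]
      simp
    rw [this, sqNorm_mulVec_of_transpose_mul_self hS]
    rfl

end WorstCase

/-! ### The saddle point -/

section Saddle

variable {n p : ℕ} {f : (Fin n → ℝ) → ℝ}

/-- A weight depending on `z` alone leaves the inner integral as a constant factor, so errors and
moments depend on `φ` only through its marginal. -/
theorem lintegral_ofReal_mul_eq_marginal (φ : (Fin n → ℝ) → (Fin n ⊕ Fin p → ℝ) → ℝ)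
    {h : (Fin n ⊕ Fin p → ℝ) → ℝ} (hh : ∀ z, 0 ≤ h z) :
    ∫⁻ z, ∫⁻ x, ENNReal.ofReal (h z * (φ x z * f x)) =
      ∫⁻ z, ENNReal.ofReal (h z) * marginal φ f z := by
  refine lintegral_congr fun z => ?_
  simp only [ENNReal.ofReal_mul (hh z)]
  rw [lintegral_const_mul' _ _ ENNReal.ofReal_ne_top, marginal]

theorem lintegral_mul_of_isGaussianDensity {ι : Type*} [Fintype ι] [DecidableEq ι]
    {F : (ι → ℝ) → ℝ≥0∞} {m : ι → ℝ} {K : Matrix ι ι ℝ} (hF : IsGaussianDensity F m K)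
    (h : (ι → ℝ) → ℝ≥0∞) :
    ∫⁻ z, h z * F z = ∫⁻ z, h z * ENNReal.ofReal (gaussPdf m K z) :=
  lintegral_congr_ae (hF.2.mono fun z hz => congrArg (h z * ·) hz)

/-- Every density in `z` is thus the marginal of a transition that ignores `x`, which is how the
worst case is realized. -/
theorem marginal_const (hf : ∫⁻ x, ENNReal.ofReal (f x) = 1) {h : (Fin n ⊕ Fin p → ℝ) → ℝ}
    (hh : ∀ z, 0 ≤ h z) (z : Fin n ⊕ Fin p → ℝ) :
    marginal (fun _ => h) f z = ENNReal.ofReal (h z) := by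
  simp only [marginal, ENNReal.ofReal_mul (hh z)]
  rw [lintegral_const_mul' _ _ ENNReal.ofReal_ne_top, hf, mul_one]

/-- The conditional mean of the nominal law and the law with the distorted conditional covariance
form a saddle point of the mean square error. -/
theorem isMinimaxSolution_of_regressionCov {τ θ c : ℝ} (hτ0 : 0 ≤ τ) (hτ1 : τ ≤ 1) (hθ : 0 < θ)
    {q : Fin n → ℝ} (hq : ∀ i, (1 - τ) * (θ * q i) < 1)
    (hc : ∑ i, scalarDiv τ (tilt τ (θ * q i)) = c) {S : Matrix (Fin n) (Fin n) ℝ} (hSu : IsUnit S)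
    (hS : Sᵀ * S = diagonal q) (G : Matrix (Fin n) (Fin p) ℝ) {Y : Matrix (Fin p) (Fin p) ℝ}
    (hY : Y.PosDef) (hf : ∫⁻ x, ENNReal.ofReal (f x) = 1)
    {φ : (Fin n → ℝ) → (Fin n ⊕ Fin p → ℝ) → ℝ} {a : Fin n → ℝ} {b : Fin p → ℝ}
    (hφ : IsGaussianDensity (marginal φ f) (Sum.elim a b) (regressionCov (S * Sᵀ) G Y)) :
    ∃ φ', IsMinimaxSolution (mse f) (ball τ φ f c) (estimators f (ball τ φ f c))
        (fun η => a + G *ᵥ (η - b)) φ' ∧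
      IsMinOn (mse f φ') (estimators f (ball τ φ f c)) (fun η => a + G *ᵥ (η - b)) ∧
      IsGaussianDensity (marginal φ' f) (Sum.elim a b)
        (regressionCov (S * diagonal (fun i => tilt τ (θ * q i)) * Sᵀ) G Y) := by
  set μ : Fin n → ℝ := fun i => tilt τ (θ * q i)
  have hμ : ∀ i, 0 < μ i := fun i => tilt_pos (hq i)
  set X := S * diagonal μ * Sᵀ
  have hX : X.PosDef := posDef_mul_diagonal_mul_transpose hSu hμ
  have htr : X.trace = ∑ i, q i * μ i := by
    rw [trace_mul_comm, ← Matrix.mul_assoc, hS, diagonal_mul_diagonal, trace_diagonal]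
  set g : (Fin p → ℝ) → Fin n → ℝ := fun η => a + G *ᵥ (η - b)
  set B := ball τ φ f c
  set φ' : (Fin n → ℝ) → (Fin n ⊕ Fin p → ℝ) → ℝ :=
    fun _ z => gaussPdf (Sum.elim a b) (regressionCov X G Y) z
  have hφ' : IsGaussianDensity (marginal φ' f) (Sum.elim a b) (regressionCov X G Y) :=
    ⟨posDef_regressionCov hX G hY,
      ae_of_all _ fun z => marginal_const hf (gaussPdf_nonneg _ _) z⟩
  -- In the whitened coordinates the distorted law has eigenvalues `μ` and `1`, so its divergence is
  -- exactly `c`.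
  have hmem : φ' ∈ B := by
    refine ⟨(continuous_gaussPdf _ _).measurable.comp measurable_snd,
      fun _ _ => gaussPdf_nonneg _ _ _, _, _, _, _, hφ', hφ, ?_⟩
    obtain ⟨R, hR, rfl⟩ := exists_isUnit_mul_transpose hY
    have e1 := blockFactor_mul_diagonal_mul_transpose S G R μ
    have e2 := blockFactor_mul_diagonal_mul_transpose S G R fun _ => 1
    rw [show (Sum.elim (fun _ => 1) fun _ => 1 : Fin n ⊕ Fin p → ℝ) = fun _ => 1 by
      ext (i | i) <;> rfl, diagonal_one, diagonal_one, Matrix.mul_one, Matrix.mul_one] at e2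
    rw [← e1, ← e2, tauDiv_eq τ _ _ (isUnit_blockFactor hSu G hR)]
    simp only [Fintype.sum_sum_type, Sum.elim_inl, Sum.elim_inr, scalarDiv_one,
      Finset.sum_const_zero, add_zero, μ, hc]
    simp
  have hupper : ∀ ψ ∈ B, mse f ψ g ≤ ENNReal.ofReal X.trace := by
    rintro ψ ⟨-, -, m', K', m, K, hψ, hφ2, hdiv⟩
    -- Membership in the ball only provides some Gaussian parameters of the nominal marginal;
    -- uniqueness identifies them.
    obtain ⟨rfl, rfl⟩ := hφ.unique hφ2
    rw [mse, lintegral_ofReal_mul_eq_marginal ψ fun z => sqNorm_nonneg _,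
      lintegral_mul_of_isGaussianDensity hψ]
    have hlin : ∀ z : Fin n ⊕ Fin p → ℝ, z ∘ Sum.inl - g (z ∘ Sum.inr) =
        fromCols (1 : Matrix (Fin n) (Fin n) ℝ) (-G) *ᵥ z +
          -(fromCols (1 : Matrix (Fin n) (Fin n) ℝ) (-G) *ᵥ Sum.elim a b) := by
      intro z
      rw [fromCols_mulVec, fromCols_mulVec]
      simp only [g, one_mulVec, neg_mulVec, Sum.elim_comp_inl, Sum.elim_comp_inr, mulVec_sub]
      abel
    simp only [hlin]
    rw [lintegral_sqNorm_gaussPdf hψ.1, ← sub_eq_add_neg, ← mulVec_sub, htr]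
    exact ENNReal.ofReal_le_ofReal
      (trace_add_sqNorm_le hτ0 hτ1 hθ hq hc hSu hS G hY hψ.1 hdiv)
  have hlower : ∀ g' : (Fin p → ℝ) → Fin n → ℝ, Measurable g' →
      ENNReal.ofReal X.trace ≤ mse f φ' g' := by
    intro g' hg'
    rw [mse, lintegral_ofReal_mul_eq_marginal φ' fun z => sqNorm_nonneg _,
      lintegral_mul_of_isGaussianDensity hφ']
    exact trace_le_lintegral_sqNorm hX G hY a b hg'
  have hgm : Measurable g := by
    have : Continuous g := by fun_prop
    exact this.measurable
  have hg : g ∈ estimators f B := by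
    refine ⟨hgm, ?_⟩
    rintro ψ ⟨-, -, m', K', m, K, hψ, -, -⟩
    rw [lintegral_ofReal_mul_eq_marginal ψ fun z => sqNorm_nonneg _,
      lintegral_mul_of_isGaussianDensity hψ]
    have hlin : ∀ z : Fin n ⊕ Fin p → ℝ, g (z ∘ Sum.inr) =
        fromCols (0 : Matrix (Fin n) (Fin n) ℝ) G *ᵥ z + (a - G *ᵥ b) := by
      intro z
      rw [fromCols_mulVec]
      simp only [g, zero_mulVec, mulVec_sub]
      abel
    simp only [hlin]
    rw [lintegral_sqNorm_gaussPdf hψ.1]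
    exact ENNReal.ofReal_lt_top
  have heq : mse f φ' g = ENNReal.ofReal X.trace :=
    le_antisymm (hupper φ' hmem) (hlower g hgm)
  refine ⟨φ', ⟨hg, hmem, fun g' hg' => ?_, fun ψ hψ => ?_⟩, fun g' hg' => ?_, hφ'⟩
  · exact (iSup₂_le hupper).trans ((hlower g' hg'.1).trans
      (le_iSup₂ (f := fun ψ (_ : ψ ∈ B) => mse f ψ g') φ' hmem))
  · exact (hupper ψ hψ).trans heq.ge
  · exact heq.le.trans (hlower g' hg'.1)

end Saddle

/-! ### One step of the recursion and its iteration -/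

section Recursion

variable {n p m : ℕ}

theorem jointCov_eq_fromBlocks (A : Matrix (Fin n) (Fin n) ℝ) (B : Matrix (Fin n) (Fin m) ℝ)
    (C : Matrix (Fin p) (Fin n) ℝ) (D : Matrix (Fin p) (Fin m) ℝ) (V : Matrix (Fin n) (Fin n) ℝ) :
    jointCov A B C D V = fromBlocks (A * V * Aᵀ + B * Bᵀ) (A * V * Cᵀ + B * Dᵀ)
      (C * V * Aᵀ + D * Bᵀ) (C * V * Cᵀ + D * Dᵀ) := by
  rw [jointCov, transpose_fromRows, transpose_fromRows, fromRows_mul, fromRows_mul_fromCols,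
    fromRows_mul_fromCols, fromBlocks_add]

theorem posDef_jointCov {A : Matrix (Fin n) (Fin n) ℝ} {B : Matrix (Fin n) (Fin m) ℝ}
    {C : Matrix (Fin p) (Fin n) ℝ} {D : Matrix (Fin p) (Fin m) ℝ} {V : Matrix (Fin n) (Fin n) ℝ}
    (hBD : (fromRows B D * (fromRows B D)ᵀ).PosDef) (hV : V.PosDef) :
    (jointCov A B C D V).PosDef := by
  have h := hV.posSemidef.mul_mul_conjTranspose_same (fromRows A C)
  rw [conjTranspose_eq_transpose_of_trivial] at h
  exact PosDef.posSemidef_add h hBD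

/-- A positive definite block matrix as the covariance of a linear regression. -/
theorem regressionCov_eq_of_posDef {ι κ : Type*} [Fintype ι] [Fintype κ]
    [DecidableEq κ] {K : Matrix (ι ⊕ κ) (ι ⊕ κ) ℝ} (hK : K.PosDef) (X : Matrix ι ι ℝ) :
    regressionCov X (K.toBlocks₁₂ * K.toBlocks₂₂⁻¹) K.toBlocks₂₂ =
      fromBlocks (X + K.toBlocks₁₂ * K.toBlocks₂₂⁻¹ * K.toBlocks₂₁)
        K.toBlocks₁₂ K.toBlocks₂₁ K.toBlocks₂₂ := by
  have h2 : K.toBlocks₂₂.PosDef := hK.submatrix (e := Sum.inr) Sum.inr_injective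
  have hd := h2.det_pos.ne'.isUnit
  have hsym : K.toBlocks₂₂ᵀ = K.toBlocks₂₂ := by simpa using h2.1.eq
  have h21 : K.toBlocks₁₂ᵀ = K.toBlocks₂₁ := by
    ext i j
    simpa [toBlocks₁₂, toBlocks₂₁] using hK.1.apply (Sum.inr i) (Sum.inl j)
  have e1 : K.toBlocks₁₂ * K.toBlocks₂₂⁻¹ * K.toBlocks₂₂ = K.toBlocks₁₂ := by
    rw [Matrix.mul_assoc, nonsing_inv_mul _ hd, Matrix.mul_one]
  have e2 : (K.toBlocks₁₂ * K.toBlocks₂₂⁻¹)ᵀ = K.toBlocks₂₂⁻¹ * K.toBlocks₂₁ := by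
    rw [transpose_mul, transpose_nonsing_inv, hsym, h21]
  rw [regressionCov, e1, e2, ← Matrix.mul_assoc K.toBlocks₂₂, mul_nonsing_inv _ hd,
    Matrix.one_mul, ← Matrix.mul_assoc]

/-- One step of the recursion. -/
theorem exists_step (hn : 0 < n) {τ : ℝ} (hτ0 : 0 ≤ τ) (hτ1 : τ ≤ 1)
    (A : Matrix (Fin n) (Fin n) ℝ) (B : Matrix (Fin n) (Fin m) ℝ)
    (C : Matrix (Fin p) (Fin n) ℝ) (D : Matrix (Fin p) (Fin m) ℝ)
    (hBD : (fromRows B D * (fromRows B D)ᵀ).PosDef) {c : ℝ} (hc : 0 < c)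
    {V : Matrix (Fin n) (Fin n) ℝ} (hV : V.PosDef) :
    ∃ (V' P : Matrix (Fin n) (Fin n) ℝ) (G : Matrix (Fin n) (Fin p) ℝ) (θ : ℝ),
      let K := jointCov A B C D V
      V'.PosDef ∧
      (C * V * Cᵀ + D * Dᵀ).PosDef ∧
      G = (A * V * Cᵀ + B * Dᵀ) * (C * V * Cᵀ + D * Dᵀ)⁻¹ ∧
      G = K.toBlocks₁₂ * K.toBlocks₂₂⁻¹ ∧
      P.PosDef ∧
      P = A * V * Aᵀ - G * (C * V * Cᵀ + D * Dᵀ) * Gᵀ + B * Bᵀ ∧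
      P = K.toBlocks₁₁ - K.toBlocks₁₂ * K.toBlocks₂₂⁻¹ * K.toBlocks₂₁ ∧
      (∀ L : Matrix (Fin n) (Fin n) ℝ, P = L * Lᵀ →
        (∀ s : ℝ, (s⁻¹ > (1 - τ) * specNorm P ∧ c = gammaTau τ L s) ↔ s = θ) ∧
        V' = distortion τ L θ) ∧
      ∀ x : Fin n → ℝ,
        let f := gaussPdf x V
        let φ := nominalTransition A B C D
        let S := ball τ φ f c
        let g : (Fin p → ℝ) → (Fin n → ℝ) := fun η => A *ᵥ x + G *ᵥ (η - C *ᵥ x)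
        IsGaussianDensity (marginal φ f) (fromRows A C *ᵥ x) K ∧
        ∃ φ', IsMinimaxSolution (mse f) S (estimators f S) g φ' ∧
          IsMinOn (mse f φ') (estimators f S) g ∧
          ∃ K', IsGaussianDensity (marginal φ' f) (fromRows A C *ᵥ x)
              (fromBlocks K' K.toBlocks₁₂ K.toBlocks₂₁ K.toBlocks₂₂) ∧
            V' = K' - K.toBlocks₁₂ * K.toBlocks₂₂⁻¹ * K.toBlocks₂₁ := by
  have : Nonempty (Fin n) := ⟨⟨0, hn⟩⟩
  have hK := posDef_jointCov (A := A) (C := C) hBD hV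
  have hKb := jointCov_eq_fromBlocks A B C D V
  set K := jointCov A B C D V with hKdef
  have h11 : K.toBlocks₁₁ = A * V * Aᵀ + B * Bᵀ := by rw [hKb, toBlocks_fromBlocks₁₁]
  have h12 : K.toBlocks₁₂ = A * V * Cᵀ + B * Dᵀ := by rw [hKb, toBlocks_fromBlocks₁₂]
  have h22 : K.toBlocks₂₂ = C * V * Cᵀ + D * Dᵀ := by rw [hKb, toBlocks_fromBlocks₂₂]
  have hreg := regressionCov_eq_of_posDef hK
  set G := K.toBlocks₁₂ * K.toBlocks₂₂⁻¹ with hG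
  set P := K.toBlocks₁₁ - G * K.toBlocks₂₁ with hP
  have hKreg : regressionCov P G K.toBlocks₂₂ = K := by
    rw [hreg, hP, sub_add_cancel, fromBlocks_toBlocks]
  obtain ⟨hPpos, hYpos⟩ := PosDef.of_regressionCov (hKreg.symm ▸ hK)
  have hPG : P = K.toBlocks₁₁ - G * K.toBlocks₂₂ * Gᵀ := by
    have := congrArg toBlocks₁₁ hKreg
    rw [regressionCov, toBlocks_fromBlocks₁₁] at this
    rw [← this, add_sub_cancel_right]
  obtain ⟨U, q, hU, hq0, hPU⟩ := exists_orthogonal_diagonal_of_posDef hPpos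
  obtain ⟨θ, hθ, hθq, hθc, huniq⟩ := exists_unique_parameter hτ0 hτ1 hc hq0
  -- Among all factors of `P`, this one makes `Sᵀ * S` diagonal, as the saddle point argument
  -- requires.
  set S := U * diagonal fun i => Real.sqrt (q i) with hSdef
  have hsq : (fun i => Real.sqrt (q i) * Real.sqrt (q i)) = q :=
    funext fun i => Real.mul_self_sqrt (hq0 i).le
  have hSS : S * Sᵀ = P := by rw [hSdef, mul_diagonal_mul_transpose, hsq, hPU]
  have hStS : Sᵀ * S = diagonal q := by
    rw [hSdef, transpose_mul, diagonal_transpose, Matrix.mul_assoc, ← Matrix.mul_assoc Uᵀ,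
      transpose_mul_self_of_orthogonal hU, Matrix.one_mul, diagonal_mul_diagonal, hsq]
  have hSu : IsUnit S := isUnit_of_mul_transpose_posDef (hSS.symm ▸ hPpos)
  refine ⟨S * diagonal (fun i => tilt τ (θ * q i)) * Sᵀ, P, G, θ,
    posDef_mul_diagonal_mul_transpose hSu fun i => tilt_pos (hθq i), h22 ▸ hYpos,
    by rw [hG, h12, h22], hG, hPpos, ?_, hP, fun L hL => ⟨fun s => ?_, ?_⟩, fun x => ?_⟩
  · rw [hPG, h11, h22]; abel
  · rw [hPU, gt_specNorm_iff hτ1 hU hq0]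
    have hUL := hPU.symm.trans hL
    constructor
    · rintro ⟨⟨hs, hsq⟩, hcs⟩
      rw [gammaTau_eq hU hq0 hUL hsq] at hcs
      exact huniq s hs hsq hcs.symm
    · rintro rfl
      exact ⟨⟨hθ, hθq⟩, by rw [gammaTau_eq hU hq0 hUL hθq, hθc]⟩
  · rw [distortion_eq hU hq0 (hPU.symm.trans hL)]
  · have hmean : fromRows A C *ᵥ x = Sum.elim (A *ᵥ x) (C *ᵥ x) := fromRows_mulVec _ _ _
    have hnom : IsGaussianDensity (marginal (nominalTransition A B C D) (gaussPdf x V))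
        (fromRows A C *ᵥ x) K :=
      ⟨hK, ae_of_all _ fun z => lintegral_gaussPdf_mul_gaussPdf hBD (fromRows A C) hV x z⟩
    refine ⟨hnom, ?_⟩
    rw [hmean] at hnom ⊢
    obtain ⟨φ', h1, h2, h3⟩ := isMinimaxSolution_of_regressionCov hτ0 hτ1 hθ hθq hθc hSu hStS
      G hYpos (lintegral_gaussPdf hV x) (by rwa [hSS, hKreg])
    -- The witness `K'` is the distorted covariance plus `K_xy K_y⁻¹ K_yx`, read off from the
    -- regression form.
    refine ⟨φ', h1, h2, _, (hreg _) ▸ h3, ?_⟩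
    rw [add_sub_cancel_right]

end Recursion

end RobustKalman

end

theorem mainTheorem1 {n p m : ℕ} (hn : 0 < n) (τ : ℝ) (hτ0 : 0 ≤ τ) (hτ1 : τ ≤ 1)
    (A : ℕ → Matrix (Fin n) (Fin n) ℝ) (B : ℕ → Matrix (Fin n) (Fin m) ℝ)
    (C : ℕ → Matrix (Fin p) (Fin n) ℝ) (D : ℕ → Matrix (Fin p) (Fin m) ℝ)
    (hBD : ∀ t, (fromRows (B t) (D t) * (fromRows (B t) (D t))ᵀ).PosDef)
    (c : ℕ → ℝ) (hc : ∀ t, 0 < c t)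
    (x₀ : Fin n → ℝ) (V₀ : Matrix (Fin n) (Fin n) ℝ) (hV₀ : V₀.PosDef) :
    ∃ (V P : ℕ → Matrix (Fin n) (Fin n) ℝ) (G : ℕ → Matrix (Fin n) (Fin p) ℝ) (θ : ℕ → ℝ),
      V 0 = V₀ ∧ ∀ t,
        let K := jointCov (A t) (B t) (C t) (D t) (V t)
        (V t).PosDef ∧
        -- gain
        (C t * V t * (C t)ᵀ + D t * (D t)ᵀ).PosDef ∧
        G t = (A t * V t * (C t)ᵀ + B t * (D t)ᵀ) * (C t * V t * (C t)ᵀ + D t * (D t)ᵀ)⁻¹ ∧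
        G t = K.toBlocks₁₂ * K.toBlocks₂₂⁻¹ ∧
        -- nominal conditional covariance
        (P (t + 1)).PosDef ∧
        P (t + 1) = A t * V t * (A t)ᵀ
          - G t * (C t * V t * (C t)ᵀ + D t * (D t)ᵀ) * (G t)ᵀ + B t * (B t)ᵀ ∧
        P (t + 1) = K.toBlocks₁₁ - K.toBlocks₁₂ * K.toBlocks₂₂⁻¹ * K.toBlocks₂₁ ∧
        -- risk sensitivity parameter and distorted covariance, for any factor of `P (t + 1)`
        (∀ L : Matrix (Fin n) (Fin n) ℝ, P (t + 1) = L * Lᵀ →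
          (∀ s : ℝ, (s⁻¹ > (1 - τ) * specNorm (P (t + 1)) ∧ c t = gammaTau τ L s) ↔ s = θ t) ∧
          V (t + 1) = distortion τ L (θ t)) ∧
        -- the filter solves the incremental minimax problem
        ∀ y : ℕ → Fin p → ℝ,
          let x := filter A C G x₀ y t
          let f := gaussPdf x (V t)
          let φ := nominalTransition (A t) (B t) (C t) (D t)
          let S := ball τ φ f (c t)
          let g : (Fin p → ℝ) → (Fin n → ℝ) := fun η => A t *ᵥ x + G t *ᵥ (η - C t *ᵥ x)
          filter A C G x₀ y (t + 1) = g (y t) ∧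
          IsGaussianDensity (marginal φ f) (fromRows (A t) (C t) *ᵥ x) K ∧
          ∃ φ', IsMinimaxSolution (mse f) S (estimators f S) g φ' ∧
            IsMinOn (mse f φ') (estimators f S) g ∧
            ∃ K', IsGaussianDensity (marginal φ' f) (fromRows (A t) (C t) *ᵥ x)
                (fromBlocks K' K.toBlocks₁₂ K.toBlocks₂₁ K.toBlocks₂₂) ∧
              V (t + 1) = K' - K.toBlocks₁₂ * K.toBlocks₂₂⁻¹ * K.toBlocks₂₁ := by
  choose V' P' G' θ' hstep using fun (t : ℕ) (V : {V : Matrix (Fin n) (Fin n) ℝ // V.PosDef}) =>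
    exists_step hn hτ0 hτ1 (A t) (B t) (C t) (D t) (hBD t) (hc t) V.2
  -- The covariances do not depend on the observations, so they are built first, with positive
  -- definiteness carried in the subtype; the step then holds for every mean `x`, in particular for
  -- the filter value.
  let W : ℕ → {V : Matrix (Fin n) (Fin n) ℝ // V.PosDef} := fun t =>
    Nat.rec ⟨V₀, hV₀⟩ (fun t V => ⟨V' t V, (hstep t V).1⟩) t
  -- The shift makes `P (t + 1)` the matrix computed from `V t`; the value `P 0` is irrelevant.
  refine ⟨fun t => (W t).1, fun t => P' (t - 1) (W (t - 1)), fun t => G' t (W t),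
    fun t => θ' t (W t), rfl, fun t => ?_⟩
  obtain ⟨-, h1, h2, h3, h4, h5, h6, h7, h8⟩ := hstep t (W t)
  exact ⟨(W t).2, h1, h2, h3, h4, h5, h6, h7, fun y => ⟨rfl, h8 _⟩⟩
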